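/- Let $\mathbb{T}^2=\mathbb{R}^2/\mathbb{Z}^2$ and let $p\ge 2$ be a real number. Let $u=(u_1,u_2)\in L^2((0,T)\times\mathbb{T}^2;\mathbb{R}^2)$ for every $T>0$ be a weak solution on $\mathbb{R}_+\times\mathbb{T}^2$ of the incompressible Euler equations $$\partial_t u+\nabla\cdot(u\otimes u)=-\nabla \pi,\qquad \operatorname{div}u=0,\qquad u(0)=0,$$ that is, $\operatorname{div}u=0$ in the sense of distributions on $(0,\infty)\times\mathbb{T}^2$, and $$\int_0^\infty\!\!\int_{\mathbb{T}^2}\Big(u\cdot\partial_t\varphi+\sum_{i,j=1}^2u_iu_j\,\partial_i\varphi_j\Big)\,dx\,dt=0$$ for every smooth compactly supported vector field $\varphi$ on $[0,\infty)\times\mathbb{T}^2$ with $\operatorname{div}\varphi=0$ (where $\varphi(0,\cdot)$ need not vanish). Assume that the distributional vorticity $\omega:=\operatorname{curl}u=\partial_1u_2-\partial_2u_1$ is a function belonging to $L^\infty(\mathbb{R}_+,L^p(\mathbb{T}^2))$. Then $u=0$ almost everywhere on $\mathbb{R}_+\times\mathbb{T}^2$. -/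

import Mathlib

open MeasureTheory Set
open scoped ContDiff

noncomputable section

namespace Euler2D

/-- The flat torus `𝕋² = ℝ² / ℤ²`; its `volume` is the normalized Lebesgue measure. -/
abbrev Torus : Type := UnitAddTorus (Fin 2)

/-- Values of velocity fields: `ℝ²` with its Euclidean norm. -/
abbrev Vec : Type := EuclideanSpace ℝ (Fin 2)

/-- The covering map `ℝ² → 𝕋²`. -/
def proj (y : Fin 2 → ℝ) : Torus := fun i => (y i : UnitAddCircle)

/-- Lebesgue measure on `(0,∞) × 𝕋²`. -/
def spaceTime : Measure (ℝ × Torus) := (volume.restrict (Ioi (0 : ℝ))).prod volume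

/-- The classical partial derivative `∂ᵢ f` at the point `x` of the torus. -/
def partialX {E : Type*} [NormedAddCommGroup E] [NormedSpace ℝ E]
    (i : Fin 2) (f : Torus → E) (x : Torus) : E :=
  deriv (fun s : ℝ => f (x + proj (Pi.single i s))) 0

/-- The classical time derivative `∂ₜ φ`. -/
def partialT {E : Type*} [NormedAddCommGroup E] [NormedSpace ℝ E]
    (φ : ℝ → Torus → E) (t : ℝ) (x : Torus) : E :=
  deriv (fun s : ℝ => φ s x) t

/-- `φ` is a smooth function on `ℝ × 𝕋²` (that is, its periodic lift to `ℝ × ℝ²` is `C^∞`) with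
compact support contained in `I × 𝕋²`. -/
structure IsTestFunction {E : Type*} [NormedAddCommGroup E] [NormedSpace ℝ E]
    (I : Set ℝ) (φ : ℝ → Torus → E) : Prop where
  smooth : ContDiff ℝ ∞ (fun z : ℝ × (Fin 2 → ℝ) => φ z.1 (proj z.2))
  compact : HasCompactSupport (fun z : ℝ × Torus => φ z.1 z.2)
  support : tsupport (fun z : ℝ × Torus => φ z.1 z.2) ⊆ I ×ˢ univ

/-- `div u = 0` in the sense of distributions on `(0,∞) × 𝕋²`. -/
def IsWeaklyDivFree (u : ℝ → Torus → Vec) : Prop :=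
  ∀ ψ : ℝ → Torus → ℝ, IsTestFunction (Ioi 0) ψ →
    ∫ z, ∑ i, u z.1 z.2 i * partialX i (ψ z.1) z.2 ∂spaceTime = 0

/-- `w = curl u = ∂₁ u₂ - ∂₂ u₁` in the sense of distributions on `(0,∞) × 𝕋²`. -/
def IsWeakCurl (u : ℝ → Torus → Vec) (w : ℝ → Torus → ℝ) : Prop :=
  ∀ ψ : ℝ → Torus → ℝ, IsTestFunction (Ioi 0) ψ →
    ∫ z, w z.1 z.2 * ψ z.1 z.2 ∂spaceTime =
      -∫ z, (u z.1 z.2 1 * partialX 0 (ψ z.1) z.2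
        - u z.1 z.2 0 * partialX 1 (ψ z.1) z.2) ∂spaceTime

/-- `f ∈ L^∞(ℝ₊, L^p(𝕋²))`. -/
def MemLinftyLp (p : ℝ) (f : ℝ → Torus → ℝ) : Prop :=
  AEStronglyMeasurable (fun z : ℝ × Torus => f z.1 z.2) spaceTime ∧
    ∃ C : NNReal, ∀ᵐ t ∂(volume.restrict (Ioi (0 : ℝ))),
      eLpNorm (f t) (ENNReal.ofReal p) volume ≤ (C : ENNReal)

/-- `u` is a weak solution on `ℝ₊ × 𝕋²` of the incompressible Euler equations
`∂ₜ u + ∇ · (u ⊗ u) = -∇ p`, `div u = 0`, `u(0) = u₀`.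

The momentum equation is tested against divergence-free smooth fields on `[0,∞) × 𝕋²` with compact
support, which eliminates the pressure (a distribution on the torus) and encodes the initial
condition. Local square integrability is what gives a meaning to `u ⊗ u`. -/
structure IsWeakSolution (u : ℝ → Torus → Vec) (u₀ : Torus → Vec) : Prop where
  initial_integrable : Integrable u₀ volume
  locallyL2 : ∀ T : ℝ, 0 < T →
    MemLp (fun z : ℝ × Torus => u z.1 z.2) 2 ((volume.restrict (Ioo (0 : ℝ) T)).prod volume)
  divFree : IsWeaklyDivFree u
  momentum : ∀ φ : ℝ → Torus → Vec, IsTestFunction univ φ →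
    (∀ t x, ∑ i, partialX i (φ t) x i = 0) →
    ∫ z, (inner ℝ (u z.1 z.2) (partialT φ z.1 z.2)
        + ∑ i, ∑ j, u z.1 z.2 i * u z.1 z.2 j * partialX i (φ z.1) z.2 j) ∂spaceTime
      + ∫ x, inner ℝ (u₀ x) (φ 0 x) = 0

end Euler2D

end

noncomputable section

namespace Euler2D

open UnitAddTorus
open scoped ComplexConjugate

/-! The theorem is conservation of energy for weak solutions with square-integrable vorticity. Since
the torus has measure one and `2 ≤ p`, the vorticity is bounded in `L²` uniformly in time. Let `S_N`
be truncation of the Fourier series to `box N`. For each `k ≠ 0`, incompressibility leaves only the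
component of the velocity coefficient along `k^⊥`. Testing the momentum equation with `χ(t)` times a
real mode in the direction `k^⊥` shows that this component is, for almost every time, the primitive
from `0` of the corresponding momentum flux (`mode_evolution`); the initial datum contributes
nothing. Squaring and summing over the box shows that the energy of `S_N u` is the time integral of
the flux `∑ ∫ u_i u_j ∂_i (S_N u_j)` (`mode_energy`, `truncFlux_eq_sum_modeTransfer`).

This flux tends to zero. A divergence-free field transports `S_N u` without changing its energy, so
one factor `u_j` may be replaced by `u_j - S_N u_j`. A Bernstein-type bound gives `|∂_i S_N u_j| ≤
(2N+1) ‖ω‖₂`, while `‖u_j - S_N u_j‖₂ ≤ (N+1)⁻¹ ‖ω - S_N ω‖₂`. The powers of `N` cancel, and the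
remaining factor `‖ω - S_N ω‖₂` tends to zero by Parseval (`abs_truncFlux_le`). Dominated
convergence in time makes the total energy of the nonzero modes vanish
(`tendsto_integral_truncFlux`, `ae_modeVel_eq_zero`). The mean has no flux, so it stays zero as well
(`ae_mean_eq_zero`), and Parseval gives `u = 0`. -/

/-! ### Fourier coefficients, Parseval and trigonometric polynomials on the torus -/

theorem volume_torus_eq :
    (volume : Measure Torus) = Measure.pi (fun _ => AddCircle.haarAddCircle) := by
  have h : (volume : Measure UnitAddCircle) = AddCircle.haarAddCircle := by
    simp [AddCircle.volume_eq_smul_haarAddCircle]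
  rw [volume_pi]
  simp only [h]

instance : IsProbabilityMeasure (volume : Measure Torus) := by
  rw [volume_torus_eq]; infer_instance

/-- Fourier coefficient with respect to the normalized Lebesgue measure of the torus. -/
def coef (f : Torus → ℂ) (n : Fin 2 → ℤ) : ℂ := ∫ x, mFourier (-n) x * f x

theorem coef_eq_mFourierCoeff (f : Torus → ℂ) (n : Fin 2 → ℤ) : coef f n = mFourierCoeff f n := by
  unfold coef mFourierCoeff
  rw [volume_torus_eq]
  rfl

theorem hasSum_sq_coef {f : Torus → ℂ} (hf : MemLp f 2 volume) :
    HasSum (fun n => ‖coef f n‖ ^ 2) (∫ x, ‖f x‖ ^ 2) := by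
  rw [volume_torus_eq] at hf
  have h := hasSum_sq_mFourierCoeff (hf.toLp f)
  have e := hf.coeFn_toLp
  convert! h using 1
  · ext n
    rw [coef_eq_mFourierCoeff]
    congr 2
    refine integral_congr_ae ?_
    filter_upwards [e] with x hx
    rw [hx]
  · rw [volume_torus_eq]
    refine integral_congr_ae ?_
    filter_upwards [e] with x hx
    rw [hx]

theorem integral_mFourier (n : Fin 2 → ℤ) :
    ∫ x : Torus, mFourier n x = if n = 0 then 1 else 0 := by
  have h := (orthonormal_iff_ite.mp (orthonormal_mFourier (d := Fin 2))) 0 n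
  simp only [ContinuousMap.inner_toLp, mFourier_zero] at h
  rw [volume_torus_eq]
  convert! h using 1
  · refine integral_congr_ae (Filter.Eventually.of_forall fun x => ?_)
    simp
  · simp [eq_comm]

theorem coef_mFourier (m n : Fin 2 → ℤ) :
    coef (mFourier m) n = if m = n then 1 else 0 := by
  unfold coef
  simp_rw [← mFourier_add, integral_mFourier]
  congr 1
  simp [neg_add_eq_zero, eq_comm]

theorem norm_mFourier_apply (n : Fin 2 → ℤ) (x : Torus) : ‖mFourier n x‖ = 1 := by
  simp only [mFourier, fourier_apply, ContinuousMap.coe_mk, norm_prod, Circle.norm_coe,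
    Finset.prod_const_one]

theorem integrable_mFourier_mul {f : Torus → ℂ} (hf : Integrable f) (n : Fin 2 → ℤ) :
    Integrable (fun x => mFourier n x * f x) :=
  hf.bdd_mul (c := 1) (mFourier n).continuous.aestronglyMeasurable
    (Filter.Eventually.of_forall fun x => (norm_mFourier_apply n x).le)

theorem coef_sub {f g : Torus → ℂ} (hf : Integrable f) (hg : Integrable g) (n : Fin 2 → ℤ) :
    coef (fun x => f x - g x) n = coef f n - coef g n := by
  unfold coef
  rw [← integral_sub (integrable_mFourier_mul hf _) (integrable_mFourier_mul hg _)]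
  simp only [mul_sub]

theorem coef_ofReal_neg (f : Torus → ℝ) (n : Fin 2 → ℤ) :
    coef (fun x => (f x : ℂ)) (-n) = conj (coef (fun x => (f x : ℂ)) n) := by
  unfold coef
  rw [← integral_conj]
  simp [mFourier_neg]

/-- The trigonometric polynomial with coefficients `a` on `s`. -/
def trigPoly (s : Finset (Fin 2 → ℤ)) (a : (Fin 2 → ℤ) → ℂ) (x : Torus) : ℂ :=
  ∑ k ∈ s, a k * mFourier k x

theorem continuous_trigPoly (s : Finset (Fin 2 → ℤ)) (a : (Fin 2 → ℤ) → ℂ) :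
    Continuous (trigPoly s a) := by
  unfold trigPoly; fun_prop

theorem memLp_of_continuous {E : Type*} [NormedAddCommGroup E] {f : Torus → E}
    (hf : Continuous f) (p : ENNReal) : MemLp f p volume := by
  obtain ⟨C, hC⟩ := isCompact_univ.exists_bound_of_continuousOn hf.continuousOn
  have : SecondCountableTopologyEither Torus E := inferInstance
  exact MemLp.of_bound hf.aestronglyMeasurable C (Filter.Eventually.of_forall fun x => hC x trivial)

theorem norm_trigPoly_le (s : Finset (Fin 2 → ℤ)) (a : (Fin 2 → ℤ) → ℂ) (x : Torus) :
    ‖trigPoly s a x‖ ≤ ∑ k ∈ s, ‖a k‖ := by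
  refine (norm_sum_le _ _).trans (Finset.sum_le_sum fun k _ => ?_)
  rw [norm_mul, norm_mFourier_apply, mul_one]

theorem coef_trigPoly (s : Finset (Fin 2 → ℤ)) (a : (Fin 2 → ℤ) → ℂ) (n : Fin 2 → ℤ) :
    coef (trigPoly s a) n = if n ∈ s then a n else 0 := by
  have : coef (trigPoly s a) n = ∑ k ∈ s, a k * coef (mFourier k) n := by
    unfold coef trigPoly
    simp_rw [Finset.mul_sum]
    rw [integral_finsetSum]
    · refine Finset.sum_congr rfl fun k _ => ?_
      rw [← integral_const_mul]
      congr 1; ext x; ring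
    · intro k _
      exact (memLp_one_iff_integrable.mp (memLp_of_continuous (by fun_prop) 1))
  rw [this]
  simp [coef_mFourier]

/-- Parseval's identity for the remainder of a truncated Fourier series. -/
theorem hasSum_sq_coef_sub_trigPoly {f : Torus → ℂ} (hf : MemLp f 2 volume)
    (s : Finset (Fin 2 → ℤ)) :
    HasSum (fun n => if n ∈ s then 0 else ‖coef f n‖ ^ 2)
      (∫ x, ‖f x - trigPoly s (coef f) x‖ ^ 2) := by
  have hg : MemLp (trigPoly s (coef f)) 2 volume :=
    memLp_of_continuous (continuous_trigPoly _ _) 2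
  convert! hasSum_sq_coef (hf.sub hg) using 2 with n
  have := coef_sub (hf.integrable (by norm_num)) (hg.integrable (by norm_num)) n
  simp only [Pi.sub_def, this, coef_trigPoly]
  split_ifs <;> simp

theorem sum_sq_coef_le {f : Torus → ℂ} (hf : MemLp f 2 volume) (s : Finset (Fin 2 → ℤ)) :
    ∑ n ∈ s, ‖coef f n‖ ^ 2 ≤ ∫ x, ‖f x‖ ^ 2 :=
  sum_le_hasSum s (fun _ _ => by positivity) (hasSum_sq_coef hf)

/-- The frequencies of sup-norm at most `N`. -/
def box (N : ℕ) : Finset (Fin 2 → ℤ) := Finset.Icc (fun _ => -(N : ℤ)) (fun _ => (N : ℤ))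

theorem mem_box {N : ℕ} {k : Fin 2 → ℤ} : k ∈ box N ↔ ∀ i, |k i| ≤ N := by
  simp only [box, Finset.mem_Icc, Pi.le_def, abs_le]
  exact ⟨fun h i => ⟨h.1 i, h.2 i⟩, fun h => ⟨fun i => (h i).1, fun i => (h i).2⟩⟩

theorem card_box (N : ℕ) : ((box N).card : ℝ) = (2 * N + 1) ^ 2 := by
  have : (box N).card = (2 * N + 1) ^ 2 := by
    rw [box, Pi.card_Icc]
    simp only [Int.card_Icc, Finset.prod_const, Finset.card_univ, Fintype.card_fin]
    congr 1
    omega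
  rw [this]; push_cast; ring

theorem tendsto_box : Filter.Tendsto box Filter.atTop Filter.atTop := by
  refine Filter.tendsto_atTop_finset_of_monotone (fun M N h k hk => ?_) fun k => ?_
  · rw [mem_box] at hk ⊢
    exact fun i => (hk i).trans (by exact_mod_cast h)
  · refine ⟨(∑ i, |k i|).toNat, mem_box.mpr fun i => ?_⟩
    rw [Int.toNat_of_nonneg (Finset.sum_nonneg fun _ _ => abs_nonneg _)]
    exact Finset.single_le_sum (f := fun i => |k i|) (fun _ _ => abs_nonneg _) (Finset.mem_univ i)

/-! ### Spatial estimate: the truncated energy flux at a fixed time -/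

/-- A divergence-free Fourier mode is controlled by its curl. -/
theorem freq_mul_norm_le {k : Fin 2 → ℤ} {a : Fin 2 → ℂ} {b : ℂ}
    (hdiv : ∑ i, (k i : ℂ) * a i = 0)
    (hcurl : b = 2 * Real.pi * Complex.I * (k 0 * a 1 - k 1 * a 0)) (i j : Fin 2) :
    2 * Real.pi * |(k i : ℝ)| * ‖a j‖ ≤ ‖b‖ := by
  rw [Fin.sum_univ_two] at hdiv
  set G : ℂ := k 0 * a 1 - k 1 * a 0 with hG
  set K : ℝ := (k 0 : ℝ) ^ 2 + (k 1 : ℝ) ^ 2 with hK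
  have hKc : (K : ℂ) = (k 0 : ℂ) ^ 2 + (k 1 : ℂ) ^ 2 := by rw [hK]; push_cast; ring
  have hb : ‖b‖ = 2 * Real.pi * ‖G‖ := by
    rw [hcurl]; simp [abs_of_pos Real.pi_pos]
  have hK0 : 0 ≤ K := by positivity
  -- Cramer's rule for the linear system formed by the divergence and the curl: up to sign, `K * a
  -- j` is `G` times the other component of `k`.
  have key : ∃ m : Fin 2, K * ‖a j‖ = |(k m : ℝ)| * ‖G‖ := by
    fin_cases j
    · refine ⟨1, ?_⟩
      have : (K : ℂ) * a 0 = -(k 1) * G := by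
        rw [hKc, hG]; linear_combination (k 0 : ℂ) * hdiv
      have := congrArg norm this
      simpa [abs_of_nonneg hK0] using this
    · refine ⟨0, ?_⟩
      have : (K : ℂ) * a 1 = (k 0) * G := by
        rw [hKc, hG]; linear_combination (k 1 : ℂ) * hdiv
      have := congrArg norm this
      simpa [abs_of_nonneg hK0] using this
  obtain ⟨m, hm⟩ := key
  have hle : ∀ n : Fin 2, (k n : ℝ) ^ 2 ≤ K := by
    intro n; fin_cases n <;> simp [hK] <;> positivity
  have h2 : |(k i : ℝ)| * |(k m : ℝ)| ≤ K := by
    nlinarith [hle i, hle m, sq_abs (k i : ℝ), sq_abs (k m : ℝ),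
      sq_nonneg (|(k i : ℝ)| - |(k m : ℝ)|)]
  rw [hb, mul_assoc]
  refine mul_le_mul_of_nonneg_left ?_ (by positivity)
  rcases hK0.eq_or_lt with h0 | h0
  · have : (k i : ℝ) = 0 := by nlinarith [hle i, sq_nonneg (k i : ℝ)]
    simp [this]
  · refine le_of_mul_le_mul_left ?_ h0
    calc K * (|(k i : ℝ)| * ‖a j‖) = |(k i : ℝ)| * |(k m : ℝ)| * ‖G‖ := by
          rw [mul_assoc, ← hm]; ring
      _ ≤ K * ‖G‖ := by gcongr

/-- The gradient coefficients of a trigonometric polynomial. -/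
def gradCoef (α : (Fin 2 → ℤ) → ℂ) (i : Fin 2) (k : Fin 2 → ℤ) : ℂ :=
  2 * Real.pi * Complex.I * k i * α k

/-- Fourier coefficients of a real function. -/
abbrev rcoef (f : Torus → ℝ) : (Fin 2 → ℤ) → ℂ := coef (fun x => (f x : ℂ))

theorem integral_mul_trigPoly_mul_conj {f : Torus → ℂ} (hf : Integrable f)
    (s : Finset (Fin 2 → ℤ)) (α β : (Fin 2 → ℤ) → ℂ) :
    ∫ x, f x * trigPoly s α x * conj (trigPoly s β x) =
      ∑ k ∈ s, ∑ l ∈ s, α k * conj (β l) * coef f (l - k) := by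
  have : ∀ x, f x * trigPoly s α x * conj (trigPoly s β x) =
      ∑ k ∈ s, ∑ l ∈ s, α k * conj (β l) * (mFourier (-(l - k)) x * f x) := by
    intro x
    simp only [trigPoly, map_sum, map_mul, ← mFourier_neg, Finset.mul_sum, Finset.sum_mul]
    rw [Finset.sum_comm]
    refine Finset.sum_congr rfl fun k _ => Finset.sum_congr rfl fun l _ => ?_
    rw [neg_sub, sub_eq_add_neg, mFourier_add]; ring
  simp_rw [this]
  rw [integral_finsetSum]
  · refine Finset.sum_congr rfl fun k _ => ?_
    rw [integral_finsetSum]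
    · refine Finset.sum_congr rfl fun l _ => ?_
      rw [integral_const_mul]; rfl
    · exact fun l _ => (integrable_mFourier_mul hf _).const_mul _
  · exact fun k _ => integrable_finsetSum _ fun l _ => (integrable_mFourier_mul hf _).const_mul _

theorem integral_mul_conj_trigPoly {f : Torus → ℂ} (hf : Integrable f)
    (s : Finset (Fin 2 → ℤ)) (β : (Fin 2 → ℤ) → ℂ) :
    ∫ x, f x * conj (trigPoly s β x) = ∑ l ∈ s, conj (β l) * coef f l := by
  have : ∀ x, f x * conj (trigPoly s β x) =
      ∑ l ∈ s, conj (β l) * (mFourier (-l) x * f x) := by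
    intro x
    simp only [trigPoly, map_sum, map_mul, ← mFourier_neg, Finset.mul_sum]
    refine Finset.sum_congr rfl fun l _ => ?_
    ring
  simp_rw [this]
  rw [integral_finsetSum]
  · refine Finset.sum_congr rfl fun l _ => ?_
    rw [integral_const_mul]; rfl
  · exact fun l _ => (integrable_mFourier_mul hf _).const_mul _

/-- A divergence-free field does not transport the energy of a trigonometric polynomial. -/
theorem re_transport_trigPoly_eq_zero {v : Fin 2 → Torus → ℝ} (hv : ∀ i, Integrable (v i))
    (hdiv : ∀ k : Fin 2 → ℤ, ∑ i, (k i : ℂ) * rcoef (v i) k = 0)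
    (s : Finset (Fin 2 → ℤ)) (α : (Fin 2 → ℤ) → ℂ) :
    (∑ i, ∫ x, (v i x : ℂ) * trigPoly s α x * conj (trigPoly s (gradCoef α i) x)).re = 0 := by
  have e := fun i => integral_mul_trigPoly_mul_conj (f := fun x => (v i x : ℂ)) (hv i).ofReal s α
    (gradCoef α i)
  simp only [e]
  rw [Finset.sum_comm, Finset.sum_congr rfl fun k _ => Finset.sum_comm]
  set X : (Fin 2 → ℤ) → (Fin 2 → ℤ) → ℂ := fun k l =>
    ∑ i, α k * conj (gradCoef α i l) * coef (fun x => (v i x : ℂ)) (l - k) with hX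
  -- `X` is anti-Hermitian: `X k l + conj (X l k)` carries the factor `∑ i, (l i - k i) * rcoef (v
  -- i) (l - k)`, which is the divergence at frequency `l - k`. The double sum is therefore purely
  -- imaginary.
  have hXX : ∀ k l, X k l = -conj (X l k) := by
    intro k l
    have h1 : ∀ i, conj (rcoef (v i) (k - l)) = rcoef (v i) (l - k) := by
      intro i; rw [← coef_ofReal_neg, neg_sub]
    have h2 := hdiv (l - k)
    simp only [hX, gradCoef, map_mul, map_neg, Complex.conj_conj, Fin.sum_univ_two, h1,
      Complex.conj_I, Complex.conj_ofReal, map_ofNat, map_intCast, map_add] at h2 ⊢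
    simp only [Pi.sub_apply, Int.cast_sub] at h2
    linear_combination (α k * conj (α l) * (-2 * Real.pi * Complex.I)) * h2
  have hZ : ∑ k ∈ s, ∑ l ∈ s, X k l = -conj (∑ k ∈ s, ∑ l ∈ s, X k l) := by
    conv_lhs => rw [Finset.sum_comm]
    simp only [map_sum, ← Finset.sum_neg_distrib]
    exact Finset.sum_congr rfl fun k _ => Finset.sum_congr rfl fun l _ => hXX l k
  have := congrArg Complex.re hZ
  simp only [Complex.neg_re, Complex.conj_re] at this
  change (∑ k ∈ s, ∑ l ∈ s, X k l).re = 0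
  linarith

theorem norm_integral_mul_mul_le {f g h : Torus → ℂ} (hf : MemLp f 2 volume)
    (hg : MemLp g 2 volume) {M : ℝ} (hh : ∀ x, ‖h x‖ ≤ M) :
    ‖∫ x, f x * g x * h x‖ ≤
      M * (√(∫ x, ‖f x‖ ^ 2) * √(∫ x, ‖g x‖ ^ 2)) := by
  have hM : 0 ≤ M := (norm_nonneg _).trans (hh 0)
  have hfg : Integrable (fun x => ‖f x‖ * ‖g x‖) := hf.norm.integrable_mul hg.norm
  refine (norm_integral_le_of_norm_le (hfg.const_mul M) (Filter.Eventually.of_forall fun x => ?_)).trans ?_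
  · rw [norm_mul, norm_mul, mul_comm]
    exact mul_le_mul_of_nonneg_right (hh x) (by positivity)
  · rw [integral_const_mul]
    refine mul_le_mul_of_nonneg_left ?_ hM
    have := integral_mul_le_Lp_mul_Lq_of_nonneg (μ := (volume : Measure Torus))
      (f := fun x => ‖f x‖) (g := fun x => ‖g x‖) Real.HolderConjugate.two_two
      (Filter.Eventually.of_forall fun _ => norm_nonneg _)
      (Filter.Eventually.of_forall fun _ => norm_nonneg _)
      (by simpa using hf.norm) (by simpa using hg.norm)
    simpa [Real.sqrt_eq_rpow] using this

/-- Truncated energy flux of the field `v`. -/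
def truncFlux (N : ℕ) (v : Fin 2 → Torus → ℝ) : ℝ :=
  (∑ i, ∑ j, ∑ k ∈ box N, conj (gradCoef (rcoef (v j)) i k) *
    rcoef (fun x => v i x * v j x) k).re

theorem norm_gradCoef {k : Fin 2 → ℤ} (α : (Fin 2 → ℤ) → ℂ) (i : Fin 2) :
    ‖gradCoef α i k‖ = 2 * Real.pi * |(k i : ℝ)| * ‖α k‖ := by
  simp [gradCoef, abs_of_pos Real.pi_pos]

/-- The commutator-type estimate behind energy conservation. Cancellation of the self-transport of
`S_N v` leaves one factor `v - S_N v`, whose decay `(N+1)⁻¹` compensates the growth `2N+1` of the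
gradient of `S_N v` in sup norm. What remains is the square root of the Parseval tail of the
vorticity, so the bound tends to zero as `N` grows. -/
theorem abs_truncFlux_le {v : Fin 2 → Torus → ℝ} (hv : ∀ i, MemLp (v i) 2 volume)
    {w : Torus → ℝ} (hw : MemLp w 2 volume)
    (hdiv : ∀ k : Fin 2 → ℤ, ∑ i, (k i : ℂ) * rcoef (v i) k = 0)
    (hcurl : ∀ k : Fin 2 → ℤ, rcoef w k =
      2 * Real.pi * Complex.I * (k 0 * rcoef (v 1) k - k 1 * rcoef (v 0) k)) (N : ℕ) :
    |truncFlux N v| ≤ 4 * (√(∫ x, v 0 x ^ 2) + √(∫ x, v 1 x ^ 2)) * √(∫ x, w x ^ 2) *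
      √((∫ x, w x ^ 2) - ∑ k ∈ box N, ‖rcoef w k‖ ^ 2) := by
  have hvc : ∀ i, MemLp (fun x => (v i x : ℂ)) 2 volume := fun i => (hv i).ofReal
  have hwc : MemLp (fun x => (w x : ℂ)) 2 volume := hw.ofReal
  have hfreq := fun k i j => freq_mul_norm_le (a := fun i => rcoef (v i) k) (hdiv k) (hcurl k) i j
  set W := ∫ x, w x ^ 2 with hW
  set R := W - ∑ k ∈ box N, ‖rcoef w k‖ ^ 2 with hR
  have hWn : ∫ x, ‖(w x : ℂ)‖ ^ 2 = W := by simp [hW]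
  let S : Fin 2 → Torus → ℂ := fun j => trigPoly (box N) (rcoef (v j))
  let D : Fin 2 → Fin 2 → Torus → ℂ := fun i j => trigPoly (box N) (gradCoef (rcoef (v j)) i)
  have hS : ∀ j, Continuous (S j) := fun j => continuous_trigPoly _ _
  have hD : ∀ i j, Continuous (D i j) := fun i j => continuous_trigPoly _ _
  have hR0 : 0 ≤ R := by
    have := sum_sq_coef_le hwc (box N)
    rw [hWn] at this
    exact sub_nonneg.mpr this
  -- Bernstein-type bound: each gradient coefficient is at most the vorticity coefficient, and
  -- Cauchy–Schwarz over the `(2N+1)^2` frequencies of the box gives the factor `2N+1`.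
  have hDsup : ∀ i j x, ‖D i j x‖ ≤ (2 * N + 1) * √W := by
    intro i j x
    refine (norm_trigPoly_le _ _ x).trans ?_
    calc ∑ k ∈ box N, ‖gradCoef (rcoef (v j)) i k‖ ≤ ∑ k ∈ box N, ‖rcoef w k‖ :=
          Finset.sum_le_sum fun k _ => by rw [norm_gradCoef]; exact hfreq k i j
      _ ≤ √(((box N).card : ℝ) * ∑ k ∈ box N, ‖rcoef w k‖ ^ 2) :=
          Real.le_sqrt_of_sq_le sq_sum_le_card_mul_sum_sq
      _ ≤ √((2 * N + 1) ^ 2 * W) := by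
          rw [card_box]
          gcongr
          exact (sum_sq_coef_le hwc _).trans_eq hWn
      _ = (2 * N + 1) * √W := by
          rw [Real.sqrt_mul (by positivity), Real.sqrt_sq (by positivity)]
  -- A frequency outside the box has a component of size at least `N + 1`, so there the velocity
  -- coefficient is at most `(N+1)⁻¹` times the vorticity coefficient.
  have htail : ∀ j, ∫ x, ‖(v j x : ℂ) - S j x‖ ^ 2 ≤ ((N + 1 : ℝ)⁻¹) ^ 2 * R := by
    intro j
    have h1 := hasSum_sq_coef_sub_trigPoly (hvc j) (box N)
    have h2 := (hasSum_sq_coef hwc).sub (hasSum_sum_of_ne_finset_zero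
      (f := fun k => if k ∈ box N then ‖rcoef w k‖ ^ 2 else 0) (s := box N) (by simp +contextual))
    have h3 := h2.mul_left (((N + 1 : ℝ)⁻¹) ^ 2)
    rw [hWn, Finset.sum_congr rfl (g := fun k => ‖rcoef w k‖ ^ 2) (by simp +contextual)] at h3
    refine hasSum_le (fun k => ?_) h1 h3
    by_cases hk : k ∈ box N
    · simp [hk]
    · simp only [hk, if_false, sub_zero]
      rw [← mul_pow]
      refine pow_le_pow_left₀ (norm_nonneg _) ?_ 2
      rw [mem_box] at hk
      push Not at hk
      obtain ⟨i, hi⟩ := hk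
      have hi' : (N + 1 : ℝ) ≤ |(k i : ℝ)| := by exact_mod_cast hi
      rw [le_inv_mul_iff₀ (by positivity)]
      refine le_trans ?_ (hfreq k i j)
      refine mul_le_mul_of_nonneg_right ?_ (norm_nonneg _)
      nlinarith [Real.pi_gt_three, abs_nonneg (k i : ℝ)]
  have hint : ∀ i j, ∑ k ∈ box N, conj (gradCoef (rcoef (v j)) i k) *
      rcoef (fun x => v i x * v j x) k = ∫ x, (v i x : ℂ) * (v j x : ℂ) * conj (D i j x) := by
    intro i j
    rw [integral_mul_conj_trigPoly (f := fun x => (v i x : ℂ) * (v j x : ℂ))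
      ((hvc i).integrable_mul (hvc j))]
    simp [rcoef]
  have hzero : ∀ j, (∑ i, ∫ x, (v i x : ℂ) * S j x * conj (D i j x)).re = 0 := fun j =>
    re_transport_trigPoly_eq_zero (fun i => (hv i).integrable (by norm_num)) hdiv (box N) _
  have hbd : ∀ i j {g : Torus → ℂ}, MemLp g 2 volume →
      Integrable (fun x => (v i x : ℂ) * g x * conj (D i j x)) := by
    intro i j g hg
    refine ((hvc i).integrable_mul hg).mul_bdd (c := (2 * N + 1) * √W)
      (by have := hD i j; fun_prop) (Filter.Eventually.of_forall fun x => ?_)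
    rw [Complex.norm_conj]
    exact hDsup i j x
  -- Subtracting `S j` from `v j` is free because the real part of the subtracted term vanishes by
  -- `hzero`; summation over `i` must be done first, for each fixed `j`.
  have hflux : truncFlux N v =
      (∑ i, ∑ j, ∫ x, (v i x : ℂ) * ((v j x : ℂ) - S j x) * conj (D i j x)).re := by
    have e : ∀ i j, ∫ x, (v i x : ℂ) * ((v j x : ℂ) - S j x) * conj (D i j x) =
        (∫ x, (v i x : ℂ) * (v j x : ℂ) * conj (D i j x)) -
          ∫ x, (v i x : ℂ) * S j x * conj (D i j x) := by
      intro i j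
      rw [← integral_sub (hbd i j (hvc j)) (hbd i j (memLp_of_continuous (hS j) 2))]
      congr 1; ext x; ring
    simp only [truncFlux, hint, e, Finset.sum_sub_distrib, Complex.sub_re]
    rw [Finset.sum_comm (f := fun i j => ∫ x, (v i x : ℂ) * S j x * conj (D i j x)),
      Complex.re_sum (f := fun j => ∑ i, ∫ x, (v i x : ℂ) * S j x * conj (D i j x))]
    simp only [hzero, Finset.sum_const_zero, sub_zero]
  have hterm : ∀ i j, ‖∫ x, (v i x : ℂ) * ((v j x : ℂ) - S j x) * conj (D i j x)‖ ≤
      2 * √W * √R * √(∫ x, v i x ^ 2) := by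
    intro i j
    refine (norm_integral_mul_mul_le (hvc i) ((hvc j).sub (memLp_of_continuous (hS j) 2))
      (h := fun x => conj (D i j x)) (M := (2 * N + 1) * √W)
      (fun x => by rw [Complex.norm_conj]; exact hDsup i j x)).trans ?_
    have h1 : √(∫ x, ‖(v j x : ℂ) - S j x‖ ^ 2) ≤ (N + 1 : ℝ)⁻¹ * √R := by
      refine (Real.sqrt_le_sqrt (htail j)).trans_eq ?_
      rw [Real.sqrt_mul (by positivity), Real.sqrt_sq (by positivity)]
    have h2 : (2 * N + 1 : ℝ) * (N + 1 : ℝ)⁻¹ ≤ 2 := by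
      rw [← div_eq_mul_inv, div_le_iff₀ (by positivity)]; linarith
    simp only [Complex.norm_real, Real.norm_eq_abs, sq_abs]
    calc (2 * N + 1) * √W * (√(∫ x, v i x ^ 2) * √(∫ x, ‖(v j x : ℂ) - S j x‖ ^ 2))
        ≤ (2 * N + 1) * √W * (√(∫ x, v i x ^ 2) * ((N + 1 : ℝ)⁻¹ * √R)) := by gcongr
      _ = ((2 * N + 1 : ℝ) * (N + 1 : ℝ)⁻¹) * (√W * √R * √(∫ x, v i x ^ 2)) := by ring
      _ ≤ 2 * (√W * √R * √(∫ x, v i x ^ 2)) := by gcongr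
      _ = _ := by ring
  rw [hflux]
  refine (Complex.abs_re_le_norm _).trans ((norm_sum_le _ _).trans ?_)
  refine (Finset.sum_le_sum fun i _ => norm_sum_le_of_le _ fun j _ => hterm i j).trans ?_
  simp only [Fin.sum_univ_two]
  exact le_of_eq (by ring)

/-! ### Weak time derivatives and primitives on the half-line -/

theorem setIntegral_Ioi_eq_intervalIntegral {g : ℝ → ℝ} {T : ℝ} (hT : 0 ≤ T)
    (hg : ∀ t, T ≤ t → g t = 0) : ∫ t in Ioi (0 : ℝ), g t = ∫ t in (0 : ℝ)..T, g t := by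
  rw [intervalIntegral.integral_of_le hT]
  refine setIntegral_eq_of_subset_of_forall_sdiff_eq_zero measurableSet_Ioi Ioc_subset_Ioi_self ?_
  intro t ht
  refine hg t (le_of_not_ge fun h => ht.2 ⟨ht.1, h⟩)

theorem absolutelyContinuousOnInterval_primitive {F : ℝ → ℝ}
    {T : ℝ} (hF : IntervalIntegrable F volume 0 T) :
    AbsolutelyContinuousOnInterval (fun t => ∫ s in (0 : ℝ)..t, F s) 0 T :=
  hF.absolutelyContinuousOnInterval_intervalIntegral (by simp)

theorem ae_deriv_primitive {F : ℝ → ℝ} {T : ℝ} (hF : IntervalIntegrable F volume 0 T) :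
    ∀ᵐ t, t ∈ uIcc 0 T → deriv (fun t => ∫ s in (0 : ℝ)..t, F s) t = F t := by
  filter_upwards [hF.ae_hasDerivAt_integral] with t ht hm
  exact (ht hm 0 (by simp)).deriv

theorem integral_mul_eq_neg_integral_primitive_mul_deriv {F χ : ℝ → ℝ} {T : ℝ}
    (hF : IntervalIntegrable F volume 0 T) (hχ : ContDiff ℝ ∞ χ) (hχT : χ T = 0) :
    ∫ t in (0 : ℝ)..T, F t * χ t = -∫ t in (0 : ℝ)..T, (∫ s in (0 : ℝ)..t, F s) * deriv χ t := by
  have hχ' : AbsolutelyContinuousOnInterval χ 0 T :=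
    (hχ.of_le (by simp)).contDiffOn.absolutelyContinuousOnInterval
  rw [(absolutelyContinuousOnInterval_primitive hF).integral_mul_deriv_eq_deriv_mul hχ', hχT]
  simp only [intervalIntegral.integral_same, mul_zero, zero_mul, sub_zero, zero_sub, neg_neg]
  refine intervalIntegral.integral_congr_ae ?_
  filter_upwards [ae_deriv_primitive hF] with t ht hm
  rw [ht (uIoc_subset_uIcc hm)]

/-- The chain rule for the square of an absolutely continuous primitive; `F` is only integrable, so
the derivative exists merely almost everywhere. -/
theorem integral_primitive_mul_self {F : ℝ → ℝ} {T : ℝ} (hF : IntervalIntegrable F volume 0 T) :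
    (∫ s in (0 : ℝ)..T, F s) ^ 2 = 2 * ∫ t in (0 : ℝ)..T, (∫ s in (0 : ℝ)..t, F s) * F t := by
  have hC := absolutelyContinuousOnInterval_primitive hF
  have h := hC.integral_deriv_mul_eq_sub hC
  simp only [intervalIntegral.integral_same, mul_zero, sub_zero] at h
  rw [sq, ← h, ← intervalIntegral.integral_const_mul]
  refine intervalIntegral.integral_congr_ae ?_
  filter_upwards [ae_deriv_primitive hF] with t ht hm
  rw [ht (uIoc_subset_uIcc hm)]
  ring

/-- A smooth compactly supported function whose derivative is prescribed on `(0,∞)`. -/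
theorem exists_primitive_compactSupport {ψ : ℝ → ℝ} (hψ : ContDiff ℝ ∞ ψ)
    (hc : HasCompactSupport ψ) :
    ∃ χ : ℝ → ℝ, ∃ T : ℝ, 0 < T ∧ ContDiff ℝ ∞ χ ∧ HasCompactSupport χ ∧
      (∀ t, 0 < t → deriv χ t = ψ t) ∧ ∀ t, T ≤ t → χ t = 0 := by
  obtain ⟨M, hM⟩ := hc.isCompact.isBounded.subset_closedBall 0
  set T : ℝ := max M 0 + 1 with hT
  have hT0 : 0 < T := by positivity
  have hψT : ∀ t, T ≤ t → ψ t = 0 := by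
    intro t ht
    by_contra h
    have := hM (subset_tsupport ψ h)
    rw [Metric.mem_closedBall, dist_zero_right] at this
    have := (le_abs_self t).trans this
    have := le_max_left M 0
    linarith
  -- Integrating from `T` makes `Ψ` vanish to the right of `T` without any zero-mean condition on
  -- `ψ`. To the left `Ψ` may be a nonzero constant, which the cutoff `η` removes on the negative
  -- axis, where nothing is prescribed.
  let Ψ : ℝ → ℝ := fun t => ∫ s in T..t, ψ s
  have hΨd : ∀ t, HasDerivAt Ψ (ψ t) t := fun t =>
    intervalIntegral.integral_hasDerivAt_right (hψ.continuous.intervalIntegrable _ _)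
      (hψ.continuous.stronglyMeasurableAtFilter _ _) hψ.continuous.continuousAt
  have hΨ : ContDiff ℝ ∞ Ψ := by
    rw [contDiff_infty_iff_deriv]
    refine ⟨fun t => (hΨd t).differentiableAt, ?_⟩
    rwa [show deriv Ψ = ψ from funext fun t => (hΨd t).deriv]
  have hΨT : ∀ t, T ≤ t → Ψ t = 0 := by
    intro t ht
    refine (intervalIntegral.integral_congr (g := fun _ => 0) fun s hs => ?_).trans (by simp)
    rw [uIcc_of_le ht] at hs
    exact hψT s hs.1
  let η : ℝ → ℝ := fun t => Real.smoothTransition (t + 2)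
  have hη : ContDiff ℝ ∞ η := Real.smoothTransition.contDiff.comp (by fun_prop)
  have hχT : ∀ t, T ≤ t → η t * Ψ t = 0 := fun t ht => by rw [hΨT t ht, mul_zero]
  refine ⟨fun t => η t * Ψ t, T, hT0, hη.mul hΨ, ?_, ?_, hχT⟩
  · refine HasCompactSupport.intro (isCompact_Icc (a := -2) (b := T)) fun t ht => ?_
    rcases lt_or_ge t (-2) with h | h
    · have : η t = 0 := Real.smoothTransition.zero_of_nonpos (by linarith)
      rw [this, zero_mul]
    · exact hχT t (le_of_not_ge fun h' => ht ⟨h, h'⟩)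
  · intro t ht
    rw [← (hΨd t).deriv]
    refine Filter.EventuallyEq.deriv_eq ?_
    filter_upwards [lt_mem_nhds ht] with s hs
    have : η s = 1 := Real.smoothTransition.one_of_one_le (by linarith)
    rw [this, one_mul]

theorem intervalIntegrable_of_integrableOn_Ioo {F : ℝ → ℝ}
    (hF : ∀ T : ℝ, 0 < T → IntegrableOn F (Ioo 0 T)) {T : ℝ} (hT : 0 ≤ T) :
    IntervalIntegrable F volume 0 T := by
  rcases hT.eq_or_lt with h | h
  · exact h ▸ IntervalIntegrable.refl
  · rw [intervalIntegrable_iff_integrableOn_Ioo_of_le hT]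
    exact hF T h

/-- A function with vanishing initial value and weak derivative `F` is the primitive of `F`. -/
theorem ae_eq_primitive_of_weak_deriv {c F : ℝ → ℝ}
    (hc : ∀ T : ℝ, 0 < T → IntegrableOn c (Ioo 0 T))
    (hF : ∀ T : ℝ, 0 < T → IntegrableOn F (Ioo 0 T))
    (h : ∀ χ : ℝ → ℝ, ContDiff ℝ ∞ χ → HasCompactSupport χ →
      ∫ t in Ioi (0 : ℝ), (c t * deriv χ t + F t * χ t) = 0) :
    ∀ᵐ t ∂(volume.restrict (Ioi (0 : ℝ))), c t = ∫ s in (0 : ℝ)..t, F s := by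
  have hFi := fun {T : ℝ} (hT : 0 ≤ T) => intervalIntegrable_of_integrableOn_Ioo hF hT
  have hci := fun {T : ℝ} (hT : 0 ≤ T) => intervalIntegrable_of_integrableOn_Ioo hc hT
  have hCi : ∀ {T : ℝ}, 0 ≤ T → IntervalIntegrable (fun t => ∫ s in (0 : ℝ)..t, F s) volume 0 T :=
    fun hT => (absolutelyContinuousOnInterval_primitive (hFi hT)).continuousOn.intervalIntegrable
  have key : ∀ᵐ t ∂volume, t ∈ Ioi (0 : ℝ) → c t - (∫ s in (0 : ℝ)..t, F s) = 0 := by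
    refine isOpen_Ioi.ae_eq_zero_of_integral_contDiff_smul_eq_zero ?_ ?_
    · intro x hx
      have hx : (0 : ℝ) < x := hx
      refine ⟨Ioc 0 (x + 1), mem_nhdsWithin_of_mem_nhds (Ioc_mem_nhds hx (by linarith)), ?_⟩
      rw [← intervalIntegrable_iff_integrableOn_Ioc_of_le (by linarith)]
      exact (hci (by linarith)).sub (hCi (by linarith))
    · intro ψ hψ hψc hψs
      -- Any `ψ` supported in `(0,∞)` agrees there with the derivative of an admissible `χ`. Since
      -- `χ 0` need not vanish, the hypothesis contains the zero initial value, and no constant of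
      -- integration is left over.
      obtain ⟨χ, T, hT, hχ, hχc, hχd, hχT⟩ := exists_primitive_compactSupport hψ hψc
      have hdT : ∀ t, T < t → deriv χ t = 0 := by
        intro t ht
        have : χ =ᶠ[nhds t] fun _ => 0 := by
          filter_upwards [lt_mem_nhds ht] with s hs using hχT s hs.le
        rw [this.deriv_eq]; simp
      have hψ0 : ∀ t, t ≤ 0 → ψ t = 0 := fun t ht => by
        by_contra hne
        exact absurd (hψs (subset_tsupport ψ hne)) (not_lt.mpr ht)
      have hψT : ∀ t, T + 1 ≤ t → ψ t = 0 := fun t ht => by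
        rw [← hχd t (by linarith), hdT t (by linarith)]
      have hT1 : 0 ≤ T + 1 := by linarith
      have h1 := h χ hχ hχc
      rw [setIntegral_Ioi_eq_intervalIntegral hT1 (fun t ht => by
        rw [hdT t (by linarith), hχT t (by linarith)]; simp)] at h1
      have hd : Continuous (deriv χ) := hχ.continuous_deriv (by simp)
      rw [intervalIntegral.integral_add ((hci hT1).mul_continuousOn hd.continuousOn)
        ((hFi hT1).mul_continuousOn hχ.continuous.continuousOn),
        integral_mul_eq_neg_integral_primitive_mul_deriv (hFi hT1) hχ (hχT _ (by linarith))] at h1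
      have h2 : ∫ t, ψ t • (c t - ∫ s in (0 : ℝ)..t, F s) =
          ∫ t in Ioi (0 : ℝ), ψ t • (c t - ∫ s in (0 : ℝ)..t, F s) := by
        rw [setIntegral_eq_integral_of_forall_compl_eq_zero]
        intro t ht
        rw [hψ0 t (not_lt.mp ht), zero_smul]
      rw [h2, setIntegral_Ioi_eq_intervalIntegral hT1 (fun t ht => by
        rw [hψT t ht, zero_smul])]
      have h3 : ∫ t in (0 : ℝ)..(T + 1), ψ t • (c t - ∫ s in (0 : ℝ)..t, F s) =
          ∫ t in (0 : ℝ)..(T + 1), (c t * deriv χ t - (∫ s in (0 : ℝ)..t, F s) * deriv χ t) := by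
        refine intervalIntegral.integral_congr_ae (Filter.Eventually.of_forall fun t ht => ?_)
        rw [uIoc_of_le hT1] at ht
        rw [hχd t ht.1, smul_eq_mul]; ring
      rw [h3, intervalIntegral.integral_sub ((hci hT1).mul_continuousOn hd.continuousOn)
        ((hCi hT1).mul_continuousOn hd.continuousOn)]
      linarith
  rw [ae_restrict_iff' measurableSet_Ioi]
  filter_upwards [key] with t ht h0
  linarith [ht h0]

/-- Energy identity for a scalar function equal a.e. to the primitive of `F`. -/
theorem sq_eq_two_mul_integral {c F : ℝ → ℝ}
    (hF : ∀ T : ℝ, 0 < T → IntegrableOn F (Ioo 0 T))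
    (h : ∀ᵐ t ∂(volume.restrict (Ioi (0 : ℝ))), c t = ∫ s in (0 : ℝ)..t, F s) :
    (∀ T : ℝ, 0 < T → IntervalIntegrable (fun t => c t * F t) volume 0 T) ∧
      ∀ᵐ t ∂(volume.restrict (Ioi (0 : ℝ))), c t ^ 2 = 2 * ∫ s in (0 : ℝ)..t, c s * F s := by
  have hFi := fun {T : ℝ} (hT : 0 ≤ T) => intervalIntegrable_of_integrableOn_Ioo hF hT
  have h' := (ae_restrict_iff' measurableSet_Ioi).mp h
  have hae : ∀ T : ℝ, 0 < T → ∀ᵐ t, t ∈ uIoc 0 T →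
      (∫ s in (0 : ℝ)..t, F s) * F t = c t * F t := by
    intro T hT
    filter_upwards [h'] with t ht hm
    rw [uIoc_of_le hT.le] at hm
    rw [ht hm.1]
  refine ⟨fun T hT => ?_, ?_⟩
  · refine ((hFi hT.le).continuousOn_mul
      (absolutelyContinuousOnInterval_primitive (hFi hT.le)).continuousOn).congr_ae ?_
    rw [Filter.EventuallyEq, ae_restrict_iff' measurableSet_uIoc]
    exact hae T hT
  · rw [ae_restrict_iff' measurableSet_Ioi]
    filter_upwards [h'] with t ht hm
    rw [ht hm, integral_primitive_mul_self (hFi (le_of_lt hm)),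
      intervalIntegral.integral_congr_ae (hae t hm)]

/-! ### Local integrability on time slabs and localization to almost every time -/

section

variable {E : Type*} [NormedAddCommGroup E]

/-- Integrability on `(0,T) × 𝕋²` for every `T > 0`. -/
def LocInt (H : ℝ × Torus → E) : Prop :=
  ∀ T : ℝ, 0 < T → Integrable H ((volume.restrict (Ioo (0 : ℝ) T)).prod volume)

theorem ae_Ioi_of_ae_Ioo {P : ℝ → Prop}
    (h : ∀ T : ℝ, 0 < T → ∀ᵐ t ∂(volume.restrict (Ioo (0 : ℝ) T)), P t) :
    ∀ᵐ t ∂(volume.restrict (Ioi (0 : ℝ))), P t := by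
  rw [ae_restrict_iff' measurableSet_Ioi]
  have h' : ∀ n : ℕ, ∀ᵐ t, t ∈ Ioo (0 : ℝ) (n + 1) → P t := fun n =>
    (ae_restrict_iff' measurableSet_Ioo).mp (h (n + 1) (by positivity))
  filter_upwards [ae_all_iff.mpr h'] with t ht hm
  obtain ⟨n, hn⟩ := exists_nat_gt t
  exact ht n ⟨hm, by linarith⟩

theorem spaceTime_restrict (T : ℝ) :
    spaceTime.restrict (Ioo 0 T ×ˢ univ) = (volume.restrict (Ioo (0 : ℝ) T)).prod volume := by
  rw [spaceTime, ← Measure.restrict_univ (μ := (volume : Measure Torus)), Measure.prod_restrict,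
    Measure.prod_restrict, Measure.restrict_restrict (measurableSet_Ioo.prod MeasurableSet.univ)]
  · congr 1
    ext z
    simp only [mem_inter_iff, mem_prod, mem_Ioo, mem_univ, and_true, mem_Ioi]
    exact ⟨fun h => h.1, fun h => ⟨h, h.1⟩⟩

theorem exists_eq_zero_of_hasCompactSupport {χ : ℝ → ℝ} (hc : HasCompactSupport χ) :
    ∃ T : ℝ, 0 < T ∧ ∀ t, T ≤ t → χ t = 0 := by
  obtain ⟨M, hM⟩ := hc.isCompact.isBounded.subset_closedBall 0
  refine ⟨max M 0 + 1, by positivity, fun t ht => ?_⟩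
  by_contra h
  have := hM (subset_tsupport χ h)
  rw [Metric.mem_closedBall, dist_zero_right] at this
  have := (le_abs_self t).trans this
  have := le_max_left M 0
  linarith

namespace LocInt

theorem slice {H : ℝ × Torus → E} (h : LocInt H) :
    ∀ᵐ t ∂(volume.restrict (Ioi (0 : ℝ))), Integrable (fun x => H (t, x)) :=
  ae_Ioi_of_ae_Ioo fun T hT => (h T hT).prod_right_ae

theorem add {H K : ℝ × Torus → E} (hH : LocInt H) (hK : LocInt K) : LocInt (fun z => H z + K z) :=
  fun T hT => (hH T hT).add (hK T hT)

theorem sum {ι : Type*} {s : Finset ι} {H : ι → ℝ × Torus → E} (hH : ∀ i ∈ s, LocInt (H i)) :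
    LocInt (fun z => ∑ i ∈ s, H i z) :=
  fun T hT => integrable_finsetSum _ fun i hi => hH i hi T hT

theorem const_mul {H : ℝ × Torus → ℂ} (hH : LocInt H) (c : ℂ) : LocInt (fun z => c * H z) :=
  fun T hT => (hH T hT).const_mul c

theorem ofReal {H : ℝ × Torus → ℝ} (hH : LocInt H) : LocInt (fun z => (H z : ℂ)) :=
  fun T hT => (hH T hT).ofReal

theorem mFourier_mul {H : ℝ × Torus → ℂ} (hH : LocInt H) (k : Fin 2 → ℤ) :
    LocInt (fun z => mFourier k z.2 * H z) :=
  fun T hT => (hH T hT).bdd_mul (c := 1)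
    ((mFourier k).continuous.comp continuous_snd).aestronglyMeasurable
    (Filter.Eventually.of_forall fun z => (norm_mFourier_apply k z.2).le)

variable [NormedSpace ℝ E]

theorem clm {F : Type*} [NormedAddCommGroup F] [NormedSpace ℝ F] {H : ℝ × Torus → E}
    (hH : LocInt H) (L : E →L[ℝ] F) : LocInt (fun z => L (H z)) :=
  fun T hT => L.integrable_comp (hH T hT)

theorem integral_slice {H : ℝ × Torus → E} (hH : LocInt H) :
    ∀ T : ℝ, 0 < T → IntegrableOn (fun t => ∫ x, H (t, x)) (Ioo 0 T) :=
  fun T hT => (hH T hT).integral_prod_left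

theorem integrable_test {H : ℝ × Torus → ℝ} (hH : LocInt H) {χ : ℝ → ℝ} (hχ : Continuous χ)
    (hc : HasCompactSupport χ) : Integrable (fun z => χ z.1 * H z) spaceTime := by
  obtain ⟨T, hT, h0⟩ := exists_eq_zero_of_hasCompactSupport hc
  obtain ⟨C, hC⟩ := hχ.bounded_above_of_compact_support hc
  have h1 : IntegrableOn (fun z => χ z.1 * H z) (Ioo 0 T ×ˢ univ) spaceTime := by
    rw [IntegrableOn, spaceTime_restrict]
    exact (hH T hT).bdd_mul (c := C) (hχ.comp continuous_fst).aestronglyMeasurable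
      (Filter.Eventually.of_forall fun z => hC z.1)
  have h2 : IntegrableOn (fun z => χ z.1 * H z) (Ioi 0 ×ˢ univ) spaceTime := by
    refine h1.of_forall_sdiff_eq_zero (measurableSet_Ioi.prod MeasurableSet.univ) fun z hz => ?_
    rw [h0 z.1, zero_mul]
    by_contra hlt
    exact hz.2 ⟨⟨hz.1.1, not_le.mp hlt⟩, trivial⟩
  rw [IntegrableOn] at h2
  have : spaceTime.restrict (Ioi 0 ×ˢ univ) = spaceTime := by
    rw [spaceTime, ← Measure.restrict_univ (μ := (volume : Measure Torus)), Measure.prod_restrict,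
      Measure.restrict_restrict (measurableSet_Ioi.prod MeasurableSet.univ), inter_self]
  rwa [this] at h2

theorem integral_test {H : ℝ × Torus → ℝ} (hH : LocInt H) {χ : ℝ → ℝ} (hχ : Continuous χ)
    (hc : HasCompactSupport χ) :
    ∫ z, χ z.1 * H z ∂spaceTime = ∫ t in Ioi (0 : ℝ), χ t * ∫ x, H (t, x) := by
  rw [spaceTime, integral_prod _ (hH.integrable_test hχ hc)]
  simp only [integral_const_mul]

theorem integral_clm {H : ℝ × Torus → ℂ} (hH : LocInt H) (L : ℂ →L[ℝ] ℝ) :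
    ∀ᵐ t ∂(volume.restrict (Ioi (0 : ℝ))), ∫ x, L (H (t, x)) = L (∫ x, H (t, x)) := by
  filter_upwards [hH.slice] with t ht
  exact L.integral_comp_comm ht

/-- Localization in time: testing against functions of time determines almost every slice. -/
theorem ae_integral_slice_eq_zero {H : ℝ × Torus → ℂ} (hH : LocInt H)
    (h : ∀ L : ℂ →L[ℝ] ℝ, ∀ χ : ℝ → ℝ, ContDiff ℝ ∞ χ → HasCompactSupport χ →
      tsupport χ ⊆ Ioi 0 → ∫ z, χ z.1 * L (H z) ∂spaceTime = 0) :
    ∀ᵐ t ∂(volume.restrict (Ioi (0 : ℝ))), ∫ x, H (t, x) = 0 := by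
  -- Test functions are real, so the complex integral is reached through real-linear functionals;
  -- the real and imaginary parts then suffice.
  have key : ∀ L : ℂ →L[ℝ] ℝ,
      ∀ᵐ t ∂(volume.restrict (Ioi (0 : ℝ))), L (∫ x, H (t, x)) = 0 := by
    intro L
    have : ∀ᵐ t ∂volume, t ∈ Ioi (0 : ℝ) → ∫ x, L (H (t, x)) = 0 := by
      refine isOpen_Ioi.ae_eq_zero_of_integral_contDiff_smul_eq_zero ?_ fun χ hχ hc hs => ?_
      · intro t ht
        have ht : (0 : ℝ) < t := ht
        exact ⟨Ioo 0 (t + 1), mem_nhdsWithin_of_mem_nhds (Ioo_mem_nhds ht (by linarith)),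
          (hH.clm L).integral_slice _ (by linarith)⟩
      · rw [← h L χ hχ hc hs, (hH.clm L).integral_test hχ.continuous hc,
          setIntegral_eq_integral_of_forall_compl_eq_zero]
        · rfl
        · intro t ht
          have : χ t = 0 := by
            by_contra hne
            exact ht (hs (subset_tsupport χ hne))
          rw [this, zero_mul]
    filter_upwards [(ae_restrict_iff' measurableSet_Ioi).mpr this, hH.integral_clm L] with t h1 h2
    rw [← h2, h1]
  filter_upwards [key Complex.reCLM, key Complex.imCLM] with t h1 h2
  exact Complex.ext h1 h2

end LocInt

/-! ### Fourier monomials as test functions -/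

/-- Derivative of a Fourier monomial along a coordinate direction. -/
theorem hasDerivAt_mFourier (m : Fin 2 → ℤ) (i : Fin 2) (x : Torus) :
    HasDerivAt (fun s : ℝ => mFourier m (x + proj (Pi.single i s)))
      (2 * Real.pi * Complex.I * m i * mFourier m x) 0 := by
  have h : ∀ s : ℝ, mFourier m (x + proj (Pi.single i s)) =
      Complex.exp (2 * Real.pi * Complex.I * m i * s) * mFourier m x := by
    intro s
    have : mFourier m (proj (Pi.single i s)) = Complex.exp (2 * Real.pi * Complex.I * m i * s) := by
      simp only [mFourier, ContinuousMap.coe_mk, proj, fourier_coe_apply]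
      rw [Finset.prod_eq_single i]
      · simp
      · intro j _ hj
        simp [hj]
      · simp
    rw [← this]
    simp only [mFourier, ContinuousMap.coe_mk, ← Finset.prod_mul_distrib]
    refine Finset.prod_congr rfl fun j _ => ?_
    simp only [fourier_apply, Pi.add_apply, smul_add, AddCircle.toCircle_add, Circle.coe_mul]
    ring
  simp only [h]
  have h1 : HasDerivAt (fun s : ℝ => 2 * Real.pi * Complex.I * m i * (s : ℂ))
      (2 * Real.pi * Complex.I * m i) 0 := by
    simpa using (Complex.ofRealCLM.hasDerivAt (x := 0)).const_mul (2 * Real.pi * Complex.I * m i)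
  simpa using (h1.cexp.mul_const (mFourier m x))

theorem contDiff_mFourier_proj (m : Fin 2 → ℤ) :
    ContDiff ℝ ∞ (fun y : Fin 2 → ℝ => mFourier m (proj y)) := by
  simp only [mFourier, ContinuousMap.coe_mk, proj, fourier_coe_apply]
  refine contDiff_prod fun i _ => ContDiff.cexp ?_
  have : ContDiff ℝ ∞ (fun y : Fin 2 → ℝ => ((y i : ℝ) : ℂ)) :=
    Complex.ofRealCLM.contDiff.comp (contDiff_apply ℝ ℝ i)
  fun_prop

variable [NormedSpace ℝ E]

/-- With `L` the real or imaginary part these are the real Fourier modes times a time cutoff. The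
direction `d` is `1` for the scalar divergence and curl conditions and a vector for the momentum
equation. -/
theorem isTestFunction_trig {χ : ℝ → ℝ} (hχ : ContDiff ℝ ∞ χ) (hc : HasCompactSupport χ)
    {I : Set ℝ} (hI : tsupport χ ⊆ I) (m : Fin 2 → ℤ) (L : ℂ →L[ℝ] ℝ) (d : E) :
    IsTestFunction I (fun t x => (χ t * L (mFourier m x)) • d) where
  smooth := by
    have h1 : ContDiff ℝ ∞ (fun z : ℝ × (Fin 2 → ℝ) => L (mFourier m (proj z.2))) :=
      L.contDiff.comp ((contDiff_mFourier_proj m).comp contDiff_snd)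
    exact ((hχ.comp contDiff_fst).mul h1).smul contDiff_const
  compact := by
    refine HasCompactSupport.intro (hc.isCompact.prod isCompact_univ) fun z hz => ?_
    have : z.1 ∉ tsupport χ := fun h => hz ⟨h, trivial⟩
    rw [image_eq_zero_of_notMem_tsupport this, zero_mul, zero_smul]
  support := by
    refine (closure_minimal (t := tsupport χ ×ˢ univ) ?_
      ((isClosed_tsupport χ).prod isClosed_univ)).trans (prod_mono hI subset_rfl)
    intro z hz
    refine ⟨subset_tsupport χ fun h => hz ?_, trivial⟩
    simp [h]

theorem partialX_trig (a : ℝ) (m : Fin 2 → ℤ) (L : ℂ →L[ℝ] ℝ) (d : E) (i : Fin 2) (x : Torus) :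
    partialX i (fun x => (a * L (mFourier m x)) • d) x =
      (a * L (2 * Real.pi * Complex.I * m i * mFourier m x)) • d := by
  unfold partialX
  have h := (L.hasFDerivAt.comp_hasDerivAt (0 : ℝ) (hasDerivAt_mFourier m i x))
  exact ((h.const_mul a).smul_const d).deriv

theorem partialT_trig {χ : ℝ → ℝ} (hχ : ContDiff ℝ ∞ χ) (m : Fin 2 → ℤ) (L : ℂ →L[ℝ] ℝ) (d : E)
    (t : ℝ) (x : Torus) :
    partialT (fun t x => (χ t * L (mFourier m x)) • d) t x =
      (deriv χ t * L (mFourier m x)) • d := by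
  unfold partialT
  have h : HasDerivAt χ (deriv χ t) t := ((hχ.differentiable (by simp)) t).hasDerivAt
  exact ((h.mul_const _).smul_const d).deriv

end

/-! ### Divergence, curl and momentum equations on the Fourier side -/

/-- The `i`-th component of the velocity at time `t`. -/
abbrev comp (u : ℝ → Torus → Vec) (t : ℝ) (i : Fin 2) (x : Torus) : ℝ := u t x i

theorem memLp_comp {α : Type*} [MeasurableSpace α] {μ : Measure α} {f : α → Vec}
    (hf : MemLp f 2 μ) (i : Fin 2) : MemLp (fun x => f x i) 2 μ :=
  hf.continuousLinearMap_comp (EuclideanSpace.proj (𝕜 := ℝ) i)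

theorem locInt_mul {u : ℝ → Torus → Vec} {u₀ : Torus → Vec} (hu : IsWeakSolution u u₀)
    (i j : Fin 2) : LocInt (fun z => comp u z.1 i z.2 * comp u z.1 j z.2) :=
  fun T hT => (memLp_comp (hu.locallyL2 T hT) i).integrable_mul (memLp_comp (hu.locallyL2 T hT) j)

theorem locInt_comp {u : ℝ → Torus → Vec} {u₀ : Torus → Vec} (hu : IsWeakSolution u u₀)
    (i : Fin 2) : LocInt (fun z => comp u z.1 i z.2) :=
  fun T hT => (memLp_comp (hu.locallyL2 T hT) i).integrable (by norm_num)

theorem ae_memLp_comp {u : ℝ → Torus → Vec} {u₀ : Torus → Vec} (hu : IsWeakSolution u u₀)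
    (i : Fin 2) : ∀ᵐ t ∂(volume.restrict (Ioi (0 : ℝ))), MemLp (comp u t i) 2 volume := by
  filter_upwards [(locInt_mul hu i i).slice, (locInt_comp hu i).slice] with t h1 h2
  rw [memLp_two_iff_integrable_sq h2.aestronglyMeasurable]
  simpa only [sq] using h1

theorem rcoef_eq_integral (f : Torus → ℝ) (k : Fin 2 → ℤ) :
    rcoef f k = ∫ x, mFourier (-k) x * (f x : ℂ) := rfl

theorem LocInt.ofReal_mFourier_mul {H : ℝ × Torus → ℝ} (hH : LocInt H) (k : Fin 2 → ℤ) :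
    LocInt (fun z => mFourier (-k) z.2 * (H z : ℂ)) := hH.ofReal.mFourier_mul (-k)

/-- Testing with the monomial of frequency `-k` isolates the coefficient at `k`. Its gradient
supplies the factors `-2πi k_i`, and localization in time turns the distributional identity into one
for almost every `t`. -/
theorem ae_div_rcoef {u : ℝ → Torus → Vec} {u₀ : Torus → Vec} (hu : IsWeakSolution u u₀)
    (k : Fin 2 → ℤ) : ∀ᵐ t ∂(volume.restrict (Ioi (0 : ℝ))),
      ∑ i, (k i : ℂ) * rcoef (comp u t i) k = 0 := by
  have hI := fun i => (locInt_comp hu i).ofReal_mFourier_mul k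
  have hH : LocInt (fun z => ∑ i, (2 * Real.pi * Complex.I * ((-k) i : ℤ) : ℂ) *
      (mFourier (-k) z.2 * (comp u z.1 i z.2 : ℂ))) :=
    LocInt.sum fun i _ => (hI i).const_mul _
  have h0 := hH.ae_integral_slice_eq_zero (fun L χ hχ hc hs => ?_)
  · filter_upwards [h0, (hI 0).slice, (hI 1).slice] with t h0 h1 h2
    simp only [Fin.sum_univ_two] at h0 ⊢
    rw [integral_add (h1.const_mul _) (h2.const_mul _), integral_const_mul, integral_const_mul,
      ← rcoef_eq_integral, ← rcoef_eq_integral] at h0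
    simp only [Pi.neg_apply, Int.cast_neg] at h0
    have hne : (2 * Real.pi * Complex.I : ℂ) ≠ 0 := Complex.two_pi_I_ne_zero
    refine (mul_eq_zero.mp (?_ : (2 * Real.pi * Complex.I : ℂ) * _ = 0)).resolve_left hne
    linear_combination -h0
  · rw [← hu.divFree _ (isTestFunction_trig hχ hc hs (-k) L (1 : ℝ))]
    congr 1
    ext z
    simp only [partialX_trig]
    rw [map_sum, Finset.mul_sum]
    refine Finset.sum_congr rfl fun i _ => ?_
    rw [smul_eq_mul, mul_one, ← mul_assoc, mul_comm _ (comp u z.1 i z.2 : ℂ), ← Complex.real_smul,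
      map_smul, smul_eq_mul]
    ring

theorem ae_curl_rcoef {u : ℝ → Torus → Vec} {u₀ : Torus → Vec} (hu : IsWeakSolution u u₀)
    {w : ℝ → Torus → ℝ} (hw : LocInt (fun z => w z.1 z.2)) (hcurl : IsWeakCurl u w)
    (k : Fin 2 → ℤ) : ∀ᵐ t ∂(volume.restrict (Ioi (0 : ℝ))),
      rcoef (w t) k = 2 * Real.pi * Complex.I *
        (k 0 * rcoef (comp u t 1) k - k 1 * rcoef (comp u t 0) k) := by
  have hI := fun i => (locInt_comp hu i).ofReal_mFourier_mul k
  have hW := hw.ofReal_mFourier_mul k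
  have hA : LocInt (fun z => (2 * Real.pi * Complex.I * ((-k) 0 : ℤ) : ℂ) *
      (mFourier (-k) z.2 * (comp u z.1 1 z.2 : ℂ)) +
      (-(2 * Real.pi * Complex.I * ((-k) 1 : ℤ)) : ℂ) *
      (mFourier (-k) z.2 * (comp u z.1 0 z.2 : ℂ))) :=
    ((hI 1).const_mul _).add ((hI 0).const_mul _)
  have h0 := (hW.add hA).ae_integral_slice_eq_zero (fun L χ hχ hc hs => ?_)
  · filter_upwards [h0, (hI 0).slice, (hI 1).slice, hW.slice, hA.slice] with
      t h0 h1 h2 h3 h4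
    rw [integral_add h3 h4,
      integral_add (h2.const_mul _) (h1.const_mul _), integral_const_mul, integral_const_mul] at h0
    simp only [← rcoef_eq_integral, Pi.neg_apply, Int.cast_neg] at h0
    linear_combination h0
  · have h := hcurl _ (isTestFunction_trig hχ hc hs (-k) L (1 : ℝ))
    simp only [map_add, mul_add]
    rw [integral_add ((hW.clm L).integrable_test hχ.continuous hc)
      (by simpa only [map_add, mul_add] using (hA.clm L).integrable_test hχ.continuous hc)]
    have e1 : ∀ z : ℝ × Torus, χ z.1 * L (mFourier (-k) z.2 * (w z.1 z.2 : ℂ)) =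
        w z.1 z.2 * ((χ z.1 * L (mFourier (-k) z.2)) • (1 : ℝ)) := by
      intro z
      rw [mul_comm (mFourier (-k) z.2), ← Complex.real_smul, map_smul, smul_eq_mul, smul_eq_mul]
      ring
    have e2 : ∀ z : ℝ × Torus, ∀ (c : ℂ) (i : Fin 2),
        L (c * (mFourier (-k) z.2 * (comp u z.1 i z.2 : ℂ))) =
          u z.1 z.2 i * L (c * mFourier (-k) z.2) := by
      intro z c i
      rw [← mul_assoc, mul_comm _ (comp u z.1 i z.2 : ℂ), ← Complex.real_smul, map_smul,
        smul_eq_mul]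
    simp only [e1, e2]
    rw [h]
    simp only [partialX_trig]
    rw [neg_add_eq_zero]
    congr 1
    ext z
    simp only [smul_eq_mul, mul_one, neg_mul, map_neg]
    ring

/-- Frequency-`k` component of the velocity in the direction `d`. -/
def modeVel (u : ℝ → Torus → Vec) (k : Fin 2 → ℤ) (d : Fin 2 → ℝ) (t : ℝ) : ℂ :=
  ∑ j, (d j : ℂ) * rcoef (comp u t j) k

/-- Frequency-`k` component of the momentum flux in the direction `d`. -/
def modeFlux (u : ℝ → Torus → Vec) (k : Fin 2 → ℤ) (d : Fin 2 → ℝ) (t : ℝ) : ℂ :=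
  ∑ i, ∑ j, (2 * Real.pi * Complex.I * ((-k) i : ℤ) * d j : ℂ) *
    rcoef (fun x => comp u t i x * comp u t j x) k

theorem integrableOn_congr_Ioi {f g : ℝ → ℝ} {T : ℝ} (hf : IntegrableOn f (Ioo 0 T))
    (h : ∀ᵐ t ∂(volume.restrict (Ioi (0 : ℝ))), f t = g t) : IntegrableOn g (Ioo 0 T) :=
  Integrable.congr hf (ae_mono (Measure.restrict_mono Ioo_subset_Ioi_self le_rfl) h)

/-- For `d` orthogonal to `k`, the real mode of frequency `-k` in the direction `d` is a
divergence-free test field, so the pressure never enters. The momentum equation then says that the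
velocity coefficient along `d` has weak derivative the flux coefficient and zero initial value. -/
theorem mode_evolution {u : ℝ → Torus → Vec} (hu : IsWeakSolution u 0)
    (k : Fin 2 → ℤ) (d : Fin 2 → ℝ) (hd : ∑ i, (k i : ℝ) * d i = 0) (L : ℂ →L[ℝ] ℝ) :
    (∀ T : ℝ, 0 < T → IntegrableOn (fun t => L (modeFlux u k d t)) (Ioo 0 T)) ∧
    ∀ᵐ t ∂(volume.restrict (Ioi (0 : ℝ))),
      L (modeVel u k d t) = ∫ s in (0 : ℝ)..t, L (modeFlux u k d s) := by
  have hI := fun i => (locInt_comp hu i).ofReal_mFourier_mul k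
  have hJ := fun i j => (locInt_mul hu i j).ofReal_mFourier_mul k
  have hH₁ : LocInt (fun z => ∑ j, (d j : ℂ) * (mFourier (-k) z.2 * (comp u z.1 j z.2 : ℂ))) :=
    LocInt.sum fun i _ => (hI i).const_mul _
  have hH₂ : LocInt (fun z => ∑ i, ∑ j, (2 * Real.pi * Complex.I * ((-k) i : ℤ) * d j : ℂ) *
      (mFourier (-k) z.2 * ((comp u z.1 i z.2 * comp u z.1 j z.2 : ℝ) : ℂ))) :=
    LocInt.sum fun i _ => LocInt.sum fun j _ => (hJ i j).const_mul _
  set H₁ : ℝ × Torus → ℂ := fun z =>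
    ∑ j, (d j : ℂ) * (mFourier (-k) z.2 * (comp u z.1 j z.2 : ℂ)) with hH₁def
  set H₂ : ℝ × Torus → ℂ := fun z =>
    ∑ i, ∑ j, (2 * Real.pi * Complex.I * ((-k) i : ℤ) * d j : ℂ) *
      (mFourier (-k) z.2 * ((comp u z.1 i z.2 * comp u z.1 j z.2 : ℝ) : ℂ)) with hH₂def
  have e₁ : ∀ᵐ t ∂(volume.restrict (Ioi (0 : ℝ))),
      ∫ x, L (H₁ (t, x)) = L (modeVel u k d t) := by
    filter_upwards [hH₁.integral_clm L, ae_all_iff.mpr fun i => (hI i).slice] with t h1 h2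
    rw [h1, modeVel]
    simp only [hH₁def]
    rw [integral_finsetSum _ fun j _ => (h2 j).const_mul _]
    simp only [integral_const_mul, rcoef_eq_integral]
  have e₂ : ∀ᵐ t ∂(volume.restrict (Ioi (0 : ℝ))),
      ∫ x, L (H₂ (t, x)) = L (modeFlux u k d t) := by
    filter_upwards [hH₂.integral_clm L,
      ae_all_iff.mpr fun i => ae_all_iff.mpr fun j => (hJ i j).slice] with t h1 h2
    rw [h1, modeFlux]
    simp only [hH₂def]
    rw [integral_finsetSum _ fun i _ => integrable_finsetSum _ fun j _ => (h2 i j).const_mul _]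
    congr 1
    refine Finset.sum_congr rfl fun i _ => ?_
    rw [integral_finsetSum _ fun j _ => (h2 i j).const_mul _]
    simp only [integral_const_mul, rcoef_eq_integral]
  have hF : ∀ T : ℝ, 0 < T → IntegrableOn (fun t => L (modeFlux u k d t)) (Ioo 0 T) :=
    fun T hT => integrableOn_congr_Ioi ((hH₂.clm L).integral_slice T hT) e₂
  have hc : ∀ T : ℝ, 0 < T → IntegrableOn (fun t => L (modeVel u k d t)) (Ioo 0 T) :=
    fun T hT => integrableOn_congr_Ioi ((hH₁.clm L).integral_slice T hT) e₁
  refine ⟨hF, ae_eq_primitive_of_weak_deriv hc hF fun χ hχ hχc => ?_⟩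
  have hχ' : Continuous (deriv χ) := hχ.continuous_deriv (by simp)
  set D : Vec := WithLp.toLp 2 d with hD
  have hm := hu.momentum _ (isTestFunction_trig hχ hχc (subset_univ _) (-k) L D) (by
    intro t x
    simp only [partialX_trig, PiLp.smul_apply, smul_eq_mul]
    have : ∀ i, (2 * Real.pi * Complex.I * ((-k) i : ℤ) * mFourier (-k) x : ℂ) =
        (-(k i) : ℝ) • (2 * Real.pi * Complex.I * mFourier (-k) x) := by
      intro i
      rw [Complex.real_smul]; simp only [Pi.neg_apply]; push_cast; ring
    simp only [this, map_smul, smul_eq_mul]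
    simp only [Fin.sum_univ_two, hD] at hd ⊢
    linear_combination (-(χ t * L (2 * Real.pi * Complex.I * mFourier (-k) x))) * hd)
  simp only [Pi.zero_apply, inner_zero_left, integral_zero, add_zero] at hm
  have hpt : ∀ z : ℝ × Torus,
      inner ℝ (u z.1 z.2) (partialT (fun t x => (χ t * L (mFourier (-k) x)) • D) z.1 z.2) +
        ∑ i, ∑ j, u z.1 z.2 i * u z.1 z.2 j *
          partialX i (fun x => (χ z.1 * L (mFourier (-k) x)) • D) z.2 j =
      deriv χ z.1 * L (H₁ z) + χ z.1 * L (H₂ z) := by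
    intro z
    rw [partialT_trig hχ]
    simp only [partialX_trig]
    congr 1
    · rw [inner_smul_right, PiLp.inner_apply, hH₁def]
      simp only [map_sum, Finset.mul_sum]
      refine Finset.sum_congr rfl fun j _ => ?_
      have : (d j : ℂ) * (mFourier (-k) z.2 * (comp u z.1 j z.2 : ℂ)) =
          (d j * comp u z.1 j z.2) • mFourier (-k) z.2 := by
        rw [Complex.real_smul]; push_cast; ring
      rw [this, map_smul]
      simp [hD]
      ring
    · rw [hH₂def]
      simp only [map_sum, Finset.mul_sum]
      refine Finset.sum_congr rfl fun i _ => Finset.sum_congr rfl fun j _ => ?_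
      have : (2 * Real.pi * Complex.I * ((-k) i : ℤ) * d j : ℂ) *
          (mFourier (-k) z.2 * ((comp u z.1 i z.2 * comp u z.1 j z.2 : ℝ) : ℂ)) =
          (d j * (comp u z.1 i z.2 * comp u z.1 j z.2)) •
            (2 * Real.pi * Complex.I * ((-k) i : ℤ) * mFourier (-k) z.2) := by
        rw [Complex.real_smul]; push_cast; ring
      rw [this, map_smul]
      simp only [hD, PiLp.smul_apply, smul_eq_mul]
      ring
  simp only [hpt] at hm
  rw [integral_add ((hH₁.clm L).integrable_test hχ' hχc.deriv)
    ((hH₂.clm L).integrable_test hχ.continuous hχc),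
    (hH₁.clm L).integral_test hχ' hχc.deriv, (hH₂.clm L).integral_test hχ.continuous hχc] at hm
  have hi : ∀ {f g : ℝ → ℝ}, Continuous g → HasCompactSupport g →
      (∀ T : ℝ, 0 < T → IntegrableOn f (Ioo 0 T)) →
      Integrable (fun t => g t * f t) (volume.restrict (Ioi 0)) := by
    intro f g hg hgc hf
    -- A function of time alone is regarded as constant in space, so that the space-time
    -- integrability lemma applies; the torus has mass one.
    have hL : LocInt (fun z : ℝ × Torus => f z.1) := fun T hT => (hf T hT).comp_fst _
    have := (hL.integrable_test hg hgc).integral_prod_left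
    simpa using this
  rw [integral_add (by simpa only [mul_comm] using hi hχ' hχc.deriv hc)
    (by simpa only [mul_comm] using hi hχ.continuous hχc hF)]
  refine Eq.trans ?_ hm
  congr 1
  · refine integral_congr_ae ?_
    filter_upwards [e₁] with t ht
    rw [ht, mul_comm]
  · refine integral_congr_ae ?_
    filter_upwards [e₂] with t ht
    rw [ht, mul_comm]

/-! ### Uniform `L²` bound and local integrability of the vorticity -/

theorem integral_sq_le_of_eLpNorm_le {f : Torus → ℝ} (hf : MemLp f 2 volume) {C : NNReal}
    (h : eLpNorm f 2 volume ≤ C) : ∫ x, f x ^ 2 ≤ (C : ℝ) ^ 2 := by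
  have h1 := hf.eLpNorm_eq_integral_rpow_norm (by norm_num) (by norm_num)
  rw [h1, ← ENNReal.ofReal_coe_nnreal] at h
  have h2 := (ENNReal.ofReal_le_ofReal_iff C.coe_nonneg).mp h
  simp only [ENNReal.toReal_ofNat, Real.rpow_ofNat, Real.norm_eq_abs, sq_abs] at h2
  rw [← one_div, ← Real.sqrt_eq_rpow] at h2
  exact (Real.sqrt_le_left C.coe_nonneg).mp h2

/-- On a probability space the `L²` norm is at most the `L^p` norm for `2 ≤ p`; the exponent plays
no further role than this reduction. -/
theorem MemLinftyLp.exists_sq_bound {p : ℝ} (hp : 2 ≤ p) {w : ℝ → Torus → ℝ}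
    (hw : MemLinftyLp p w) : ∃ M : ℝ, 0 ≤ M ∧ ∀ᵐ t ∂(volume.restrict (Ioi (0 : ℝ))),
      MemLp (w t) 2 volume ∧ ∫ x, w t x ^ 2 ≤ M := by
  obtain ⟨hm, C, hC⟩ := hw
  refine ⟨(C : ℝ) ^ 2, by positivity, ?_⟩
  filter_upwards [hC, hm.prodMk_left] with t h1 h2
  have h3 : eLpNorm (w t) 2 volume ≤ C :=
    (eLpNorm_le_eLpNorm_of_exponent_le (by
      rw [← ENNReal.ofReal_ofNat]; exact ENNReal.ofReal_le_ofReal hp) h2).trans h1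
  have h4 : MemLp (w t) 2 volume := ⟨h2, h3.trans_lt ENNReal.coe_lt_top⟩
  exact ⟨h4, integral_sq_le_of_eLpNorm_le h4 h3⟩

theorem MemLinftyLp.locInt {p : ℝ} (hp : 2 ≤ p) {w : ℝ → Torus → ℝ}
    (hw : MemLinftyLp p w) : LocInt (fun z => w z.1 z.2) := by
  intro T hT
  obtain ⟨M, hM, h⟩ := hw.exists_sq_bound hp
  have hle : volume.restrict (Ioo (0 : ℝ) T) ≤ volume.restrict (Ioi (0 : ℝ)) :=
    Measure.restrict_mono Ioo_subset_Ioi_self le_rfl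
  have hm : AEStronglyMeasurable (fun z : ℝ × Torus => w z.1 z.2)
      ((volume.restrict (Ioo (0 : ℝ) T)).prod volume) := by
    rw [← spaceTime_restrict]; exact hw.1.restrict
  rw [integrable_prod_iff hm]
  have h' := ae_mono hle h
  refine ⟨?_, ?_⟩
  · filter_upwards [h'] with t ht using ht.1.integrable (by norm_num)
  · refine Integrable.mono' (integrable_const (1 + M)) hm.norm.integral_prod_right' ?_
    filter_upwards [h'] with t ht
    rw [Real.norm_of_nonneg (integral_nonneg fun _ => norm_nonneg _)]
    have h1 : ∫ x, ‖w t x‖ ≤ ∫ x, (1 + w t x ^ 2) := by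
      refine integral_mono (ht.1.integrable (by norm_num)).norm
        ((integrable_const _).add ht.1.integrable_sq) fun x => ?_
      rw [Real.norm_eq_abs]
      nlinarith [sq_abs (w t x), sq_nonneg (|w t x| - 1), abs_nonneg (w t x)]
    rw [integral_add (integrable_const _) ht.1.integrable_sq] at h1
    simp only [integral_const, probReal_univ, smul_eq_mul, mul_one] at h1
    linarith [ht.2]

/-! ### Energy balance of single modes -/

/-- The rotated frequency `k^⊥`. -/
def perp (k : Fin 2 → ℤ) : Fin 2 → ℝ := ![-(k 1 : ℝ), (k 0 : ℝ)]

/-- The squared length of a frequency. -/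
def normSqFreq (k : Fin 2 → ℤ) : ℝ := (k 0 : ℝ) ^ 2 + (k 1 : ℝ) ^ 2

theorem normSqFreq_pos {k : Fin 2 → ℤ} (hk : k ≠ 0) : 0 < normSqFreq k := by
  unfold normSqFreq
  obtain ⟨i, hi⟩ := Function.ne_iff.mp hk
  have hi' : (k i : ℝ) ≠ 0 := by exact_mod_cast hi
  fin_cases i
  · have : 0 < (k 0 : ℝ) ^ 2 := by positivity
    positivity
  · have : 0 < (k 1 : ℝ) ^ 2 := by positivity
    positivity

/-- A vector orthogonal to `k` is a multiple of `k^⊥`, so the single scalar `modeVel u k (perp k) t`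
determines the whole coefficient when `k ≠ 0`. -/
theorem normSqFreq_mul_rcoef {u : ℝ → Torus → Vec} {t : ℝ} {k : Fin 2 → ℤ}
    (hdiv : ∑ i, (k i : ℂ) * rcoef (comp u t i) k = 0) (j : Fin 2) :
    (normSqFreq k : ℂ) * rcoef (comp u t j) k = perp k j * modeVel u k (perp k) t := by
  simp only [Fin.sum_univ_two] at hdiv
  fin_cases j
  · simp [normSqFreq, perp, modeVel]
    linear_combination (k 0 : ℂ) * hdiv
  · simp [normSqFreq, perp, modeVel]
    linear_combination (k 1 : ℂ) * hdiv

/-- Density of energy transfer at frequency `k`. -/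
def modeTransfer (u : ℝ → Torus → Vec) (k : Fin 2 → ℤ) (t : ℝ) : ℝ :=
  (modeVel u k (perp k) t).re * (modeFlux u k (perp k) t).re +
    (modeVel u k (perp k) t).im * (modeFlux u k (perp k) t).im

/-- Links the physical-space flux, which can be estimated, to the modal transfers, whose time
integrals are known. The weight `(normSqFreq k)⁻¹` appears because `perp k` is not normalized. -/
theorem truncFlux_eq_sum_modeTransfer {u : ℝ → Torus → Vec} {t : ℝ}
    (hdiv : ∀ k : Fin 2 → ℤ, ∑ i, (k i : ℂ) * rcoef (comp u t i) k = 0) (N : ℕ) :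
    truncFlux N (comp u t) = ∑ k ∈ box N, (normSqFreq k)⁻¹ * modeTransfer u k t := by
  unfold truncFlux
  rw [Finset.sum_congr rfl fun i _ => Finset.sum_comm, Finset.sum_comm, Complex.re_sum]
  refine Finset.sum_congr rfl fun k _ => ?_
  have h1 : modeTransfer u k t =
      (conj (modeVel u k (perp k) t) * modeFlux u k (perp k) t).re := by
    simp [modeTransfer]
  rw [h1, ← Complex.re_ofReal_mul]
  congr 1
  -- At `k = 0` the gradient coefficient vanishes, and the right side vanishes too by the convention
  -- that the inverse of zero is zero.
  by_cases hk : k = 0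
  · simp [hk, gradCoef, normSqFreq]
  have hK : ((normSqFreq k : ℝ) : ℂ) ≠ 0 := by exact_mod_cast (normSqFreq_pos hk).ne'
  rw [Complex.ofReal_inv, eq_inv_mul_iff_mul_eq₀ hK, modeFlux, Finset.mul_sum, Finset.mul_sum]
  refine Finset.sum_congr rfl fun i _ => ?_
  rw [Finset.mul_sum, Finset.mul_sum]
  refine Finset.sum_congr rfl fun j _ => ?_
  have h2 := congrArg conj (normSqFreq_mul_rcoef (hdiv k) j)
  simp only [map_mul, Complex.conj_ofReal] at h2
  simp only [gradCoef, map_mul, Complex.conj_I, Complex.conj_ofReal, map_ofNat, map_intCast,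
    Pi.neg_apply, Int.cast_neg]
  linear_combination (-2 * Real.pi * Complex.I * k i *
    rcoef (fun x => comp u t i x * comp u t j x) k) * h2

/-- The scalar energy identity applied to the real and imaginary parts of the mode, which are
separately primitives of those of the flux. -/
theorem mode_energy {u : ℝ → Torus → Vec} (hu : IsWeakSolution u 0) (k : Fin 2 → ℤ) :
    (∀ T : ℝ, 0 < T → IntervalIntegrable (modeTransfer u k) volume 0 T) ∧
    ∀ᵐ t ∂(volume.restrict (Ioi (0 : ℝ))),
      ‖modeVel u k (perp k) t‖ ^ 2 = 2 * ∫ s in (0 : ℝ)..t, modeTransfer u k s := by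
  have hd : ∑ i, (k i : ℝ) * perp k i = 0 := by
    simp only [perp, Fin.sum_univ_two, Matrix.cons_val_zero, Matrix.cons_val_one]; ring
  have h := fun L => mode_evolution hu k (perp k) hd L
  obtain ⟨i1, a1⟩ := sq_eq_two_mul_integral (h Complex.reCLM).1 (h Complex.reCLM).2
  obtain ⟨i2, a2⟩ := sq_eq_two_mul_integral (h Complex.imCLM).1 (h Complex.imCLM).2
  refine ⟨fun T hT => (i1 T hT).add (i2 T hT), ?_⟩
  filter_upwards [a1, a2, ae_restrict_mem measurableSet_Ioi] with t h1 h2 ht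
  rw [Complex.sq_norm, Complex.normSq_apply, ← sq, ← sq]
  simp only [Complex.reCLM_apply, Complex.imCLM_apply] at h1 h2 i1 i2
  simp only [modeTransfer]
  rw [h1, h2, intervalIntegral.integral_add (i1 t ht) (i2 t ht)]
  ring

/-- Constant fields are divergence-free, and the flux coefficient carries a factor `k`, which is
zero here; the mean is thus conserved. -/
theorem ae_mean_eq_zero {u : ℝ → Torus → Vec} (hu : IsWeakSolution u 0) (j : Fin 2) :
    ∀ᵐ t ∂(volume.restrict (Ioi (0 : ℝ))), rcoef (comp u t j) 0 = 0 := by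
  have h := fun L => (mode_evolution hu 0 (Pi.single j 1) (by simp) L).2
  filter_upwards [h Complex.reCLM, h Complex.imCLM] with t h1 h2
  have e : modeVel u 0 (Pi.single j 1) t = rcoef (comp u t j) 0 := by
    rw [modeVel, Finset.sum_eq_single j]
    · simp
    · intro i _ hi; simp [hi]
    · simp
  have e2 : ∀ s, modeFlux u 0 (Pi.single j 1) s = 0 := by intro s; simp [modeFlux]
  simp only [e, e2, map_zero, intervalIntegral.integral_zero] at h1 h2
  exact Complex.ext h1 h2

/-! ### Vanishing of the flux and of the energy -/

/-- The truncated energy fluxes vanish in the limit. -/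
theorem tendsto_integral_truncFlux {u : ℝ → Torus → Vec} (hu : IsWeakSolution u 0)
    {w : ℝ → Torus → ℝ} (hwL : LocInt (fun z => w z.1 z.2)) (hcurl : IsWeakCurl u w) {M : ℝ}
    (hw : ∀ᵐ t ∂(volume.restrict (Ioi (0 : ℝ))),
      MemLp (w t) 2 volume ∧ ∫ x, w t x ^ 2 ≤ M) {t : ℝ} (ht : 0 < t) :
    Filter.Tendsto (fun N : ℕ => ∫ s in (0 : ℝ)..t, truncFlux N (comp u s)) Filter.atTop
      (nhds 0) := by
  have hdiv := ae_all_iff.mpr (ae_div_rcoef hu)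
  have hcurl' := ae_all_iff.mpr (ae_curl_rcoef hu hwL hcurl)
  have hu2 := ae_all_iff.mpr (ae_memLp_comp hu)
  have hrestr : ∀ {P : ℝ → Prop}, (∀ᵐ s ∂(volume.restrict (Ioi (0 : ℝ))), P s) →
      ∀ᵐ s, s ∈ uIoc 0 t → P s := by
    intro P hP
    rw [ae_restrict_iff' measurableSet_Ioi] at hP
    filter_upwards [hP] with s hs hm
    rw [uIoc_of_le ht.le] at hm
    exact hs hm.1
  have hbound := hrestr (P := fun s => ∀ N : ℕ, |truncFlux N (comp u s)| ≤
      4 * (√(∫ x, comp u s 0 x ^ 2) + √(∫ x, comp u s 1 x ^ 2)) * √(∫ x, w s x ^ 2) *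
      √((∫ x, w s x ^ 2) - ∑ k ∈ box N, ‖rcoef (w s) k‖ ^ 2)) (by
    filter_upwards [hdiv, hcurl', hu2, hw] with s h1 h2 h3 h4 N
    exact abs_truncFlux_le h3 h4.1 h1 h2 N)
  suffices key : Filter.Tendsto (fun N : ℕ => ∫ s in (0 : ℝ)..t, truncFlux N (comp u s))
      Filter.atTop (nhds (∫ _ in (0 : ℝ)..t, (0 : ℝ))) by simpa using key
  refine intervalIntegral.tendsto_integral_filter_of_dominated_convergence
    -- The dominating function comes from the flux bound by `√V ≤ 1 + V` for the two velocity
    -- integrals, and by bounding the product of the vorticity norm and its tail by `M`. It is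
    -- integrable in time because `u` is square integrable on slabs.
    (fun s => 4 * (2 + (∫ x, comp u s 0 x ^ 2) + (∫ x, comp u s 1 x ^ 2)) * M)
    (Filter.Eventually.of_forall fun N => ?_) (Filter.Eventually.of_forall fun N => ?_) ?_ ?_
  -- Measurability in time of the flux is read off from its expression as a finite sum of modal
  -- transfers.
  · have h1 : IntervalIntegrable (fun s => ∑ k ∈ box N, (normSqFreq k)⁻¹ * modeTransfer u k s)
        volume 0 t := by
      have := IntervalIntegrable.sum (box N) (f := fun k s => (normSqFreq k)⁻¹ * modeTransfer u k s)
        (μ := volume) (a := 0) (b := t) fun k _ => ((mode_energy hu k).1 t ht).const_mul _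
      simpa only [Finset.sum_fn] using this
    refine h1.aestronglyMeasurable_restrict_uIoc.congr ?_
    rw [Filter.EventuallyEq, ae_restrict_iff' measurableSet_uIoc]
    filter_upwards [hrestr hdiv] with s hs hm
    rw [truncFlux_eq_sum_modeTransfer (hs hm)]
  · filter_upwards [hbound, hrestr hw] with s h1 h2 hm
    obtain ⟨-, h2⟩ := h2 hm
    refine (h1 hm N).trans ?_
    set W := ∫ x, w s x ^ 2
    have hV : ∀ V : ℝ, 0 ≤ V → √V ≤ 1 + V := fun V hV => by
      nlinarith [Real.sq_sqrt hV, sq_nonneg (√V - 1), Real.sqrt_nonneg V]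
    have hW0 : 0 ≤ W := integral_nonneg fun x => sq_nonneg _
    have hR : √(W - ∑ k ∈ box N, ‖rcoef (w s) k‖ ^ 2) ≤ √W :=
      Real.sqrt_le_sqrt (sub_le_self _ (Finset.sum_nonneg fun _ _ => by positivity))
    have h3 := hV (∫ x, comp u s 0 x ^ 2) (integral_nonneg fun x => sq_nonneg _)
    have h4 := hV (∫ x, comp u s 1 x ^ 2) (integral_nonneg fun x => sq_nonneg _)
    have h5 : √W * √(W - ∑ k ∈ box N, ‖rcoef (w s) k‖ ^ 2) ≤ M :=
      (mul_le_mul_of_nonneg_left hR (Real.sqrt_nonneg _)).trans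
        ((Real.mul_self_sqrt hW0).le.trans h2)
    rw [mul_assoc]
    have h6 := (Real.sqrt_nonneg (∫ x, comp u s 0 x ^ 2))
    have h7 := (Real.sqrt_nonneg (∫ x, comp u s 1 x ^ 2))
    refine mul_le_mul (by linarith) h5 (by positivity) (by linarith)
  · have hV : ∀ i, IntervalIntegrable (fun s => ∫ x, comp u s i x ^ 2) volume 0 t := by
      intro i
      refine intervalIntegrable_of_integrableOn_Ioo (fun T hT => ?_) ht.le
      simpa only [sq] using (locInt_mul hu i i).integral_slice T hT
    exact (((intervalIntegrable_const.add (hV 0)).add (hV 1)).const_mul 4).mul_const M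
  · filter_upwards [hbound, hrestr hw] with s h1 h2 hm
    rw [tendsto_zero_iff_abs_tendsto_zero]
    refine squeeze_zero (fun N => abs_nonneg _) (h1 hm) ?_
    -- Parseval along the exhausting boxes: the vorticity tail tends to zero for almost every fixed
    -- time.
    have h3 := (hasSum_sq_coef (f := fun x => (w s x : ℂ)) (h2 hm).1.ofReal).comp tendsto_box
    simp only [Complex.norm_real, Real.norm_eq_abs, sq_abs] at h3
    have h4 := ((h3.const_sub (∫ x, w s x ^ 2)).sqrt).const_mul
      (4 * (√(∫ x, comp u s 0 x ^ 2) + √(∫ x, comp u s 1 x ^ 2)) * √(∫ x, w s x ^ 2))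
    simpa using h4

/-- The weighted energy in the box is twice the integrated flux, which tends to zero. Its terms are
nonnegative, so each of them is bounded by the whole sum once the box contains its frequency, and
must vanish. -/
theorem ae_modeVel_eq_zero {u : ℝ → Torus → Vec} (hu : IsWeakSolution u 0)
    {w : ℝ → Torus → ℝ} (hwL : LocInt (fun z => w z.1 z.2)) (hcurl : IsWeakCurl u w) {M : ℝ}
    (hw : ∀ᵐ t ∂(volume.restrict (Ioi (0 : ℝ))),
      MemLp (w t) 2 volume ∧ ∫ x, w t x ^ 2 ≤ M) :
    ∀ᵐ t ∂(volume.restrict (Ioi (0 : ℝ))), ∀ k, k ≠ 0 → modeVel u k (perp k) t = 0 := by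
  have hdiv := (ae_restrict_iff' measurableSet_Ioi).mp (ae_all_iff.mpr (ae_div_rcoef hu))
  filter_upwards [ae_all_iff.mpr fun k => (mode_energy hu k).2, ae_restrict_mem measurableSet_Ioi]
    with t h ht k hk
  have ht : 0 < t := ht
  have hE : ∀ N : ℕ, ∑ k ∈ box N, (normSqFreq k)⁻¹ * ‖modeVel u k (perp k) t‖ ^ 2 =
      2 * ∫ s in (0 : ℝ)..t, truncFlux N (comp u s) := by
    intro N
    have e : ∫ s in (0 : ℝ)..t, truncFlux N (comp u s) =
        ∫ s in (0 : ℝ)..t, ∑ k ∈ box N, (normSqFreq k)⁻¹ * modeTransfer u k s := by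
      refine intervalIntegral.integral_congr_ae ?_
      filter_upwards [hdiv] with s hs hm
      rw [uIoc_of_le ht.le] at hm
      exact truncFlux_eq_sum_modeTransfer (hs hm.1) N
    rw [e, intervalIntegral.integral_finsetSum fun k _ => ((mode_energy hu k).1 t ht).const_mul _,
      Finset.mul_sum]
    refine Finset.sum_congr rfl fun k _ => ?_
    rw [h k, intervalIntegral.integral_const_mul]
    ring
  have hlim := (tendsto_integral_truncFlux hu hwL hcurl hw ht).const_mul 2
  rw [mul_zero] at hlim
  have hle : (normSqFreq k)⁻¹ * ‖modeVel u k (perp k) t‖ ^ 2 ≤ 0 := by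
    refine ge_of_tendsto hlim ?_
    filter_upwards [tendsto_box.eventually (Filter.eventually_ge_atTop {k})] with N hN
    rw [← hE N]
    refine Finset.single_le_sum (f := fun k => (normSqFreq k)⁻¹ * ‖modeVel u k (perp k) t‖ ^ 2)
      (fun k _ => ?_) (hN (Finset.mem_singleton_self k))
    have : 0 ≤ normSqFreq k := by unfold normSqFreq; positivity
    positivity
  have hK := inv_pos.mpr (normSqFreq_pos hk)
  have h2 : ‖modeVel u k (perp k) t‖ ^ 2 ≤ 0 := by
    by_contra hne
    exact absurd hle (not_le.mpr (mul_pos hK (not_le.mp hne)))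
  exact norm_eq_zero.mp (pow_eq_zero_iff (two_ne_zero) |>.mp (le_antisymm h2 (by positivity)))

/-- All coefficients vanish, the mean by conservation and the others through their `k^⊥` component;
Parseval concludes. -/
theorem ae_integral_sq_eq_zero {u : ℝ → Torus → Vec} (hu : IsWeakSolution u 0)
    {w : ℝ → Torus → ℝ} (hwL : LocInt (fun z => w z.1 z.2)) (hcurl : IsWeakCurl u w) {M : ℝ}
    (hw : ∀ᵐ t ∂(volume.restrict (Ioi (0 : ℝ))),
      MemLp (w t) 2 volume ∧ ∫ x, w t x ^ 2 ≤ M) (j : Fin 2) :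
    ∀ᵐ t ∂(volume.restrict (Ioi (0 : ℝ))), ∫ x, comp u t j x * comp u t j x = 0 := by
  filter_upwards [ae_modeVel_eq_zero hu hwL hcurl hw, ae_mean_eq_zero hu j, ae_memLp_comp hu j,
    ae_all_iff.mpr (ae_div_rcoef hu)] with t h1 h2 h3 h4
  have hz : ∀ k, rcoef (comp u t j) k = 0 := by
    intro k
    by_cases hk : k = 0
    · rw [hk, h2]
    · have h5 := normSqFreq_mul_rcoef (h4 k) j
      rw [h1 k hk, mul_zero] at h5
      exact (mul_eq_zero.mp h5).resolve_left (by exact_mod_cast (normSqFreq_pos hk).ne')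
  have h6 := hasSum_sq_coef (f := fun x => (comp u t j x : ℂ)) h3.ofReal
  have h7 : ∀ k, coef (fun x => (comp u t j x : ℂ)) k = 0 := hz
  simp only [h7, norm_zero, ne_eq, OfNat.ofNat_ne_zero, not_false_eq_true, zero_pow,
    Complex.norm_real, Real.norm_eq_abs, sq_abs] at h6
  simpa only [sq] using (h6.unique hasSum_zero)

theorem ae_comp_eq_zero {u : ℝ → Torus → Vec} (hu : IsWeakSolution u 0) (j : Fin 2)
    (h : ∀ᵐ t ∂(volume.restrict (Ioi (0 : ℝ))), ∫ x, comp u t j x * comp u t j x = 0) :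
    ∀ᵐ z ∂spaceTime, comp u z.1 j z.2 = 0 := by
  have h1 : ∀ T : ℝ, 0 < T →
      ∀ᵐ z ∂(spaceTime.restrict (Ioo 0 T ×ˢ univ)), comp u z.1 j z.2 = 0 := by
    intro T hT
    rw [spaceTime_restrict]
    have hI := locInt_mul hu j j T hT
    have h2 : ∫ z, comp u z.1 j z.2 * comp u z.1 j z.2
        ∂((volume.restrict (Ioo (0 : ℝ) T)).prod volume) = 0 := by
      rw [integral_prod _ hI]
      refine integral_eq_zero_of_ae ?_
      exact ae_mono (Measure.restrict_mono Ioo_subset_Ioi_self le_rfl) h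
    rw [integral_eq_zero_iff_of_nonneg (fun z => mul_self_nonneg _) hI] at h2
    filter_upwards [h2] with z hz
    exact mul_self_eq_zero.mp hz
  have h2 : ∀ n : ℕ, ∀ᵐ z ∂spaceTime, z ∈ Ioo (0 : ℝ) (n + 1) ×ˢ (univ : Set Torus) →
      comp u z.1 j z.2 = 0 := fun n =>
    (ae_restrict_iff' (measurableSet_Ioo.prod MeasurableSet.univ)).mp (h1 (n + 1) (by positivity))
  have h3 : ∀ᵐ z ∂spaceTime, z.1 ∈ Ioi (0 : ℝ) :=
    Measure.quasiMeasurePreserving_fst.ae (ae_restrict_mem measurableSet_Ioi)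
  filter_upwards [ae_all_iff.mpr h2, h3] with z hz hpos
  obtain ⟨n, hn⟩ := exists_nat_gt z.1
  exact hz n ⟨⟨hpos, by linarith⟩, trivial⟩

end Euler2D

end


theorem mainTheorem7 (p : ℝ) (hp : 2 ≤ p)
    (u : ℝ → Euler2D.Torus → Euler2D.Vec)
    (hu : Euler2D.IsWeakSolution u 0)
    (w : ℝ → Euler2D.Torus → ℝ)
    (hcurl : Euler2D.IsWeakCurl u w)
    (hw : Euler2D.MemLinftyLp p w) :
    ∀ᵐ z ∂Euler2D.spaceTime, u z.1 z.2 = 0 := by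
  obtain ⟨M, -, hM⟩ := hw.exists_sq_bound hp
  have h := fun j => Euler2D.ae_comp_eq_zero hu j
    (Euler2D.ae_integral_sq_eq_zero hu (hw.locInt hp) hcurl hM j)
  filter_upwards [h 0, h 1] with z h0 h1
  ext j
  fin_cases j
  · exact h0
  · exact h1
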